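/- Let $M$ be a smooth $(2n+1)$-dimensional manifold (Hausdorff, second countable, without boundary) with a globally defined contact form $\theta$, i.e. a smooth $1$-form such that $\theta_m\neq 0$ and $\omega_m:=d\theta_m|_{\mathcal C_m}$ is nondegenerate on $\mathcal C_m:=\ker\theta_m$ for every $m\in M$. Let $Z$ be the Reeb field ($\theta(Z)=1$, $Z\,\lrcorner\, d\theta=0$). For $f\in C^\infty(M)$, the Hamiltonian vector field $Y_f$ is the section of $\mathcal C$ determined by $Y_f\,\lrcorner\, d\theta=df-df(Z)\,\theta$. Let $\pi:M^{(1)}\to M$ be the prolongation of $M$, the set of all pairs $(m,L)$ with $m\in M$ and $L\subset\mathcal C_m$ a Lagrangian ($n$-dimensional isotropic) subspace of $(\mathcal C_m,\omega_m)$. For a subspace $U\subset T_mM$ let $$U^{(1)}=\{(m,L)\in M^{(1)} : L\supseteq U\cap \mathcal C_m\}\ \text{ if }\dim U\le n,\qquad U^{(1)}=\{(m,L)\in M^{(1)} : L\subseteq U\cap\mathcal C_m\}\ \text{ if }\dim U\ge n$$ (both conditions being required if $\dim U=n$), and for a submanifold $\Sigma\subset M$ let $\Sigma^{(1)}=\bigcup_{m\in\Sigma}(T_m\Sigma)^{(1)}$.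 A Lagrangian submanifold is an $n$-dimensional embedded submanifold $\Sigma\subset M$ with $T_m\Sigma\subset\mathcal C_m$ for all $m\in\Sigma$. Let $\mathcal E\subset M^{(1)}$ be a second order PDE, i.e. a hypersurface of $M^{(1)}$; more generally, let $\mathcal E$ be any subset of $M^{(1)}$. A solution of $\mathcal E$ is a Lagrangian submanifold $\Sigma$ with $\Sigma^{(1)}\subset\mathcal E$. A function $f\in C^\infty(M)$ is called an intermediate integral of $\mathcal E$ if, for every $c\in\mathbb R$, every Lagrangian submanifold $\Sigma$ contained in $\{f=c\}$ (i.e. every solution of the first order PDE $f=c$) is a solution of $\mathcal E$. A subspace $U\subset T_mM$ is called strongly characteristic for $\mathcal E$ if $U^{(1)}\subset\mathcal E$, and a curve in $M$ is called strongly characteristic for $\mathcal E$ if the subspaces spanned by its velocity vectors are. **Theorem.** Let $f\in C^\infty(M)$ be such that $Y_f$ vanishes at no point of $M$ (equivalently, $df$ and $\theta$ are linearly independent at every point). Then $f$ is an intermediate integral of $\mathcal E$ if and only if all integral curves of $Y_f$ are strongly characteristic for $\mathcal E$. -/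

import Mathlib

open Set Module
open scoped Manifold ContDiff Topology Bundle

noncomputable section

namespace ContactGeometry

/-- The model vector space `ℝ^(2n+1)` of a `(2n+1)`-dimensional manifold. -/
abbrev Model (n : ℕ) : Type := EuclideanSpace ℝ (Fin (2 * n + 1))

/-- The model with corners of boundaryless `(2n+1)`-dimensional manifolds. -/
abbrev model (n : ℕ) : ModelWithCorners ℝ (Model n) (Model n) := 𝓘(ℝ, Model n)

section Contact

variable {n : ℕ} {M : Type*} [TopologicalSpace M] [ChartedSpace (Model n) M]

/-- The coordinate expression `(φ⁻¹)^* θ` of a `1`-form `θ` in the preferred chart `φ` at `m`. -/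
def coordForm (θ : ∀ x : M, TangentSpace (model n) x →L[ℝ] ℝ) (m : M) :
    Model n → (Model n →L[ℝ] ℝ) := fun y =>
  (θ ((extChartAt (model n) m).symm y)).comp
    (mfderiv (model n) (model n) (extChartAt (model n) m).symm y)

/-- The differential at `m` of the preferred chart at `m`. -/
def chartDifferential (m : M) : TangentSpace (model n) m →L[ℝ] Model n :=
  mfderiv (model n) (model n) (extChartAt (model n) m) m

/-- The differential `df_m` of a function `f`. -/
def differential (f : M → ℝ) (m : M) : TangentSpace (model n) m →L[ℝ] ℝ :=
  mfderiv (model n) 𝓘(ℝ, ℝ) f m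

/-- The exterior derivative of a `1`-form `θ` at `m`, computed in the preferred chart `φ` at `m`:
if `θ̃ = (φ⁻¹)^* θ`, then `dθ(u, v) = (D_{φ_* u} θ̃)(φ_* v) - (D_{φ_* v} θ̃)(φ_* u)`. -/
def dForm (θ : ∀ x : M, TangentSpace (model n) x →L[ℝ] ℝ) (m : M) :
    TangentSpace (model n) m →ₗ[ℝ] TangentSpace (model n) m →ₗ[ℝ] ℝ :=
  LinearMap.mk₂ ℝ
    (fun u v =>
      fderiv ℝ (coordForm θ m) (extChartAt (model n) m m)
          (chartDifferential m u) (chartDifferential m v) -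
        fderiv ℝ (coordForm θ m) (extChartAt (model n) m m)
          (chartDifferential m v) (chartDifferential m u))
    (fun u u' v => by simp only [map_add, add_apply]; ring)
    (fun c u v => by simp only [map_smul, smul_apply, smul_eq_mul]; ring)
    (fun u v v' => by simp only [map_add, add_apply]; ring)
    (fun c u v => by simp only [map_smul, smul_apply, smul_eq_mul]; ring)

/-- `dForm` is Mathlib's exterior derivative of the coordinate expression of the form. -/
theorem dForm_eq_extDeriv (θ : ∀ x : M, TangentSpace (model n) x →L[ℝ] ℝ) (m : M)
    (h : DifferentiableAt ℝ (coordForm θ m) (extChartAt (model n) m m))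
    (u v : TangentSpace (model n) m) :
    dForm θ m u v =
      extDeriv (fun y => ContinuousAlternatingMap.ofSubsingletonLIE (𝕜 := ℝ) (E := Model n)
          (F := ℝ) (0 : Fin 1) (coordForm θ m y)) (extChartAt (model n) m m)
        ![chartDifferential m u, chartDifferential m v] := by
  have hd := ((ContinuousAlternatingMap.ofSubsingletonLIE (𝕜 := ℝ) (E := Model n)
      (F := ℝ) (0 : Fin 1)).toContinuousLinearEquiv.hasFDerivAt.comp _ h.hasFDerivAt)
  have hd' := hd.fderiv
  simp only [Function.comp_def] at hd'
  rw [extDeriv]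
  erw [hd']
  simp [dForm, ContinuousAlternatingMap.alternatizeUncurryFin_apply, Fin.sum_univ_two,
    ContinuousAlternatingMap.ofSubsingletonLIE, Fin.removeNth, sub_eq_add_neg]

variable (n M) in
/-- A globally defined contact form on the `(2n+1)`-dimensional manifold `M`: a smooth nowhere
vanishing `1`-form `θ` such that `dθ` is nondegenerate on each hyperplane `𝒞_m = ker θ_m`. -/
structure ContactForm [IsManifold (model n) ∞ M] where
  /-- the underlying family of covectors -/
  form : ∀ x : M, TangentSpace (model n) x →L[ℝ] ℝ
  smooth : ContMDiff (model n) ((model n).prod 𝓘(ℝ, Model n →L[ℝ] ℝ)) ∞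
    (fun x => Bundle.TotalSpace.mk' (Model n →L[ℝ] ℝ)
      (E := fun x => TangentSpace (model n) x →L[ℝ] Bundle.Trivial M ℝ x) x (form x))
  ne_zero : ∀ m, form m ≠ 0
  nondegenerate : ∀ m, ∀ u : TangentSpace (model n) m, form m u = 0 →
    (∀ v : TangentSpace (model n) m, form m v = 0 → dForm form m u v = 0) → u = 0

variable [IsManifold (model n) ∞ M] (θ : ContactForm n M)

/-- The contact hyperplane `𝒞_m = ker θ_m`. -/
def ContactForm.plane (m : M) : Submodule ℝ (TangentSpace (model n) m) :=
  LinearMap.ker (θ.form m : TangentSpace (model n) m →ₗ[ℝ] ℝ)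

instance (m : M) : FiniteDimensional ℝ (TangentSpace (model n) m) :=
  inferInstanceAs (FiniteDimensional ℝ (Model n))

theorem dForm_swap (m : M) (u v : TangentSpace (model n) m) :
    dForm θ.form m u v = - dForm θ.form m v u := by
  simp only [dForm, LinearMap.mk₂_apply]
  ring

theorem dForm_self (m : M) (u : TangentSpace (model n) m) : dForm θ.form m u u = 0 := by
  simp only [dForm, LinearMap.mk₂_apply]
  ring

/-- Every covector on `𝒞_m` is `dθ(Y, ·)` for some `Y ∈ 𝒞_m`. -/
theorem exists_dual (m : M) (α : TangentSpace (model n) m →ₗ[ℝ] ℝ) :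
    ∃ Y : TangentSpace (model n) m, θ.form m Y = 0 ∧
      ∀ v, θ.form m v = 0 → dForm θ.form m Y v = α v := by
  let B : θ.plane m →ₗ[ℝ] Dual ℝ (θ.plane m) :=
    (dForm θ.form m).domRestrict₁₂ (θ.plane m) (θ.plane m)
  have hinj : Function.Injective B := by
    rw [← LinearMap.ker_eq_bot, LinearMap.ker_eq_bot']
    intro u hu
    apply Subtype.ext
    refine θ.nondegenerate m u.1 u.2 fun v hv => ?_
    exact LinearMap.congr_fun hu (⟨v, hv⟩ : θ.plane m)
  have hsurj : Function.Surjective B :=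
    (LinearMap.injective_iff_surjective_of_finrank_eq_finrank
      (Subspace.dual_finrank_eq (K := ℝ) (V := θ.plane m)).symm).1 hinj
  obtain ⟨Y, hY⟩ := hsurj (α.domRestrict (θ.plane m))
  exact ⟨Y.1, Y.2, fun v hv => LinearMap.congr_fun hY (⟨v, hv⟩ : θ.plane m)⟩

theorem exists_reeb (m : M) : ∃ Z : TangentSpace (model n) m,
    θ.form m Z = 1 ∧ ∀ v, dForm θ.form m Z v = 0 := by
  obtain ⟨e, he⟩ : ∃ e, θ.form m e = 1 := by
    obtain ⟨e, he⟩ : ∃ e, θ.form m e ≠ 0 := by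
      by_contra! hcon
      exact θ.ne_zero m (ContinuousLinearMap.ext hcon)
    refine ⟨(θ.form m e)⁻¹ • e, ?_⟩
    rw [(θ.form m).map_smul, smul_eq_mul, inv_mul_cancel₀ he]
  obtain ⟨w, hw, hwv⟩ := exists_dual θ m (dForm θ.form m e)
  have hC : ∀ v, θ.form m v = 0 → dForm θ.form m (e - w) v = 0 := fun v hv => by
    rw [map_sub, LinearMap.sub_apply, hwv v hv, sub_self]
  have h1 : θ.form m (e - w) = 1 := by rw [(θ.form m).map_sub, he, hw, sub_zero]
  refine ⟨e - w, h1, fun v => ?_⟩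
  have hv : θ.form m (v - θ.form m v • (e - w)) = 0 := by
    rw [(θ.form m).map_sub, (θ.form m).map_smul, h1, smul_eq_mul, mul_one, sub_self]
  have := hC _ hv
  rwa [map_sub, map_smul, dForm_self, smul_zero, sub_zero] at this

/-- The Reeb vector field `Z` of `θ`: `θ(Z) = 1`, `Z ⌟ dθ = 0`. -/
def ContactForm.reeb (m : M) : TangentSpace (model n) m :=
  Classical.choose (exists_reeb θ m)

theorem exists_hamiltonian (f : M → ℝ) (m : M) : ∃ Y : TangentSpace (model n) m,
    θ.form m Y = 0 ∧ ∀ v, dForm θ.form m Y v =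
      differential f m v -
        differential f m (θ.reeb m) * θ.form m v := by
  obtain ⟨hZ, hZv⟩ := Classical.choose_spec (exists_reeb θ m)
  change θ.form m (θ.reeb m) = 1 at hZ
  change ∀ v, dForm θ.form m (θ.reeb m) v = 0 at hZv
  let α : TangentSpace (model n) m →ₗ[ℝ] ℝ :=
    (differential (n := n) f m).toLinearMap
  obtain ⟨Y, hY, hYv⟩ := exists_dual θ m α
  refine ⟨Y, hY, fun v => ?_⟩
  have hv : θ.form m (v - θ.form m v • θ.reeb m) = 0 := by
    rw [(θ.form m).map_sub, (θ.form m).map_smul, hZ, smul_eq_mul, mul_one, sub_self]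
  have := hYv _ hv
  rw [map_sub, map_smul, dForm_swap θ m Y (θ.reeb m), hZv, neg_zero, smul_zero, sub_zero,
    map_sub, map_smul, smul_eq_mul] at this
  exact this.trans (congrArg (α v - ·) (mul_comm _ _))

/-- The Hamiltonian vector field `Y_f` of a function `f` on `M`: the Cartan field (`θ(Y_f) = 0`)
with `Y_f ⌟ dθ = df - df(Z) θ`, where `Z` is the Reeb field. -/
def ContactForm.hamiltonian (f : M → ℝ) (m : M) : TangentSpace (model n) m :=
  Classical.choose (exists_hamiltonian θ f m)

/-- The two conditions determine the Reeb field. -/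
theorem reeb_unique (m : M) (Z : TangentSpace (model n) m) (h1 : θ.form m Z = 1)
    (h2 : ∀ v, dForm θ.form m Z v = 0) : Z = θ.reeb m := by
  obtain ⟨hZ, hZv⟩ := Classical.choose_spec (exists_reeb θ m)
  change θ.form m (θ.reeb m) = 1 at hZ
  change ∀ v, dForm θ.form m (θ.reeb m) v = 0 at hZv
  refine sub_eq_zero.1 (θ.nondegenerate m _ ?_ fun v _ => ?_)
  · rw [(θ.form m).map_sub, h1, hZ, sub_self]
  · rw [map_sub, LinearMap.sub_apply, h2, hZv, sub_zero]

/-- The two conditions determine the Hamiltonian field. -/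
theorem hamiltonian_unique (f : M → ℝ) (m : M) (Y : TangentSpace (model n) m)
    (h1 : θ.form m Y = 0) (h2 : ∀ v, dForm θ.form m Y v =
      differential f m v -
        differential f m (θ.reeb m) * θ.form m v) :
    Y = θ.hamiltonian f m := by
  obtain ⟨hY, hYv⟩ := Classical.choose_spec (exists_hamiltonian θ f m)
  change θ.form m (θ.hamiltonian f m) = 0 at hY
  refine sub_eq_zero.1 (θ.nondegenerate m _ ?_ fun v _ => ?_)
  · rw [(θ.form m).map_sub, h1, hY, sub_self]
  · rw [map_sub, LinearMap.sub_apply, h2]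
    exact sub_eq_zero.2 (hYv v).symm

/-- `L` is a Lagrangian plane of `(𝒞_m, ω_m)`, `ω = dθ|_𝒞`. -/
structure IsLagrangianPlane (m : M) (L : Submodule ℝ (TangentSpace (model n) m)) : Prop where
  le_plane : L ≤ θ.plane m
  isotropic : ∀ u ∈ L, ∀ v ∈ L, dForm θ.form m u v = 0
  finrank_eq : finrank ℝ L = n

/-- The prolongation `M^(1)`: the set of all Lagrangian planes of the contact distribution.
Second order PDEs are the hypersurfaces `E` of `M^(1)`. The notions below make sense, and are
defined, for arbitrary subsets `E` of `M^(1)`. -/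
structure Prolongation where
  /-- the point `m` of `M` under `m¹` -/
  base : M
  /-- the Lagrangian plane `L_{m¹}` -/
  plane : Submodule ℝ (TangentSpace (model n) base)
  isLagrangian : IsLagrangianPlane θ base plane

/-- The prolongation `U^(1)` of a subspace `U ⊆ T_m M`: the Lagrangian planes `L` of `𝒞_m` with
`L ⊇ U ∩ 𝒞_m` if `dim U ≤ n`, and with `L ⊆ U ∩ 𝒞_m` if `dim U ≥ n`. -/
def prolongSubspace (m : M) (U : Submodule ℝ (TangentSpace (model n) m)) :
    Set (Prolongation θ) :=
  {q | ∃ (L : Submodule ℝ (TangentSpace (model n) m)) (hL : IsLagrangianPlane θ m L),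
    q = ⟨m, L, hL⟩ ∧
    (finrank ℝ U ≤ n → U ⊓ θ.plane m ≤ L) ∧ (n ≤ finrank ℝ U → L ≤ U ⊓ θ.plane m)}

/-- `S` is a smooth (embedded) `k`-dimensional submanifold of `M`: near each of its points there is
a smooth chart of `M` that maps `S` onto a piece of a `k`-dimensional linear subspace. -/
def IsSubmanifold (k : ℕ) (S : Set M) : Prop :=
  ∀ m ∈ S, ∃ φ ∈ IsManifold.maximalAtlas (model n) ∞ M, m ∈ φ.source ∧
    ∃ V : Submodule ℝ (Model n), finrank ℝ V = k ∧
      φ '' (S ∩ φ.source) = φ.target ∩ (V : Set (Model n))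

/-- The tangent space `T_m S ⊆ T_m M` of a submanifold `S` at `m ∈ S`: the vectors `v` with
`dg(v) = 0` for each function `g`, smooth near `m`, that vanishes on `S` near `m`. -/
def tangentSpaceOf (S : Set M) (m : M) : Submodule ℝ (TangentSpace (model n) m) where
  carrier := {v | ∀ g : M → ℝ, ContMDiffAt (model n) 𝓘(ℝ, ℝ) ∞ g m →
    (∀ᶠ x in 𝓝[S] m, g x = 0) → differential g m v = 0}
  zero_mem' := fun g _ _ => map_zero _
  add_mem' := fun {u v} hu hv g hg h => by rw [map_add, hu g hg h, hv g hg h, add_zero]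
  smul_mem' := fun c v hv g hg h => by rw [map_smul, hv g hg h, smul_zero]

/-- A Lagrangian submanifold of `(M, 𝒞)`: an `n`-dimensional integral submanifold of `𝒞`. -/
structure IsLagrangianSubmanifold (S : Set M) : Prop where
  isSubmanifold : IsSubmanifold (n := n) n S
  integral : ∀ m ∈ S, tangentSpaceOf (n := n) S m ≤ θ.plane m

/-- The prolongation `S^(1) ⊆ M^(1)` of a submanifold `S` of `M`: all prolongations of its
tangent spaces. -/
def prolongSubmanifold (S : Set M) : Set (Prolongation θ) :=
  ⋃ m ∈ S, prolongSubspace θ m (tangentSpaceOf S m)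

/-- A (Lagrangian) solution `S` of the first order PDE `F ⊆ M`. -/
def IsFirstOrderSolution (F : Set M) (S : Set M) : Prop :=
  IsLagrangianSubmanifold θ S ∧ S ⊆ F

/-- A solution of the second order PDE `E ⊆ M^(1)`: a Lagrangian submanifold `S` with
`S^(1) ⊆ E`. -/
def IsSecondOrderSolution (E : Set (Prolongation θ)) (S : Set M) : Prop :=
  IsLagrangianSubmanifold θ S ∧ prolongSubmanifold θ S ⊆ E

/-- `f` is an intermediate integral of `E`: for each constant `c`, all solutions of the first
order PDE `f = c` are solutions of `E`. -/
def IsIntermediateIntegral (E : Set (Prolongation θ)) (f : M → ℝ) : Prop :=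
  ∀ c : ℝ, ∀ S : Set M, IsFirstOrderSolution θ {m | f m - c = 0} S → IsSecondOrderSolution θ E S

/-- A subspace `U ⊆ T_m M` is strongly characteristic for `E` if `U^(1) ⊆ E`. -/
def IsStronglyCharacteristic (E : Set (Prolongation θ)) (m : M)
    (U : Submodule ℝ (TangentSpace (model n) m)) : Prop :=
  prolongSubspace θ m U ⊆ E

/-- A curve, defined on `J ⊆ ℝ`, is strongly characteristic for `E` if all its tangent spaces
(spanned by its velocities) are. -/
def IsStronglyCharacteristicCurve (E : Set (Prolongation θ)) (γ : ℝ → M) (J : Set ℝ) : Prop :=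
  ∀ t ∈ J, IsStronglyCharacteristic θ E (γ t)
    (Submodule.span ℝ {(mfderiv 𝓘(ℝ, ℝ) (model n) γ t) (1 : ℝ)})

end Contact

end ContactGeometry

end

open ContactGeometry

/-! Both sides say the same thing about Lagrangian planes: every Lagrangian plane `L` of `𝒞_m` that
contains `Y_f(m)` belongs to `E`. For the characteristic side this is linear algebra plus the
existence of an integral curve through each point
(`forall_integralCurve_isStronglyCharacteristic_iff`, `prolongSubspace_span_hamiltonian`).

If a Lagrangian submanifold lies in a level of `f`, then `df` kills its tangent spaces, so `dθ(Y_f,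
·) = df - df(Z) θ` vanishes on any Lagrangian plane `L` inside such a tangent space. Since `L` is
maximal isotropic, it contains `Y_f` (`IsLagrangianPlane.mem_of_forall`), hence it lies in `E` when
the integral curves are strongly characteristic.

Conversely, each Lagrangian `L` containing `Y_f(m)` must be realized as the tangent space of a
Lagrangian submanifold in a level of `f` (`exists_lagrangianSubmanifold`). In a chart this is proved
for isotropic subspaces of any positive dimension, by induction on the dimension
(`exists_isotropicImmersion`). A section of the level of `f` transversal to `Y_f`, of codimension 2
in the ambient space, inherits a contact form (`IsContactAt.reduction`). The part of `L` tangent to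
the section is isotropic of one dimension less and, by induction, is tangent to an isotropic
immersion into the section. Flowing this immersion out along `Y_f` restores the missing dimension
(`exists_flowOut`). The flow preserves `f`, and the pullback of the contact form satisfies a
homogeneous linear equation along the flow lines, so it remains zero. The flow-out needs a flow that
is jointly smooth in time and initial point (`exists_smooth_flow`), obtained from the inverse
function theorem on a space of paths. -/

noncomputable section

namespace ContactGeometry

/-! ### Local inverses and smooth extension of germs -/

section Calculus

/-- A smooth map with invertible derivative at a point is, near this point, a diffeomorphism of
open sets. -/
theorem exists_smooth_localInverse {X Y : Type*} [NormedAddCommGroup X] [NormedSpace ℝ X]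
    [CompleteSpace X] [NormedAddCommGroup Y] [NormedSpace ℝ Y] [CompleteSpace Y]
    {f : X → Y} (hf : ContDiff ℝ ∞ f) (a : X) (f' : X ≃L[ℝ] Y)
    (hf' : HasFDerivAt f (f' : X →L[ℝ] Y) a) :
    ∃ e : OpenPartialHomeomorph X Y, a ∈ e.source ∧ ⇑e = f ∧ ContDiffOn ℝ ∞ e.symm e.target ∧
      ∀ x ∈ e.source, (fderiv ℝ f x).IsInvertible := by
  have hn : (∞ : WithTop ℕ∞) ≠ 0 := by simp
  let e₀ := hf.contDiffAt.toOpenPartialHomeomorph f hf' hn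
  have he₀ : ⇑e₀ = f := hf.contDiffAt.toOpenPartialHomeomorph_coe hf' hn
  have ha₀ : a ∈ e₀.source := hf.contDiffAt.mem_toOpenPartialHomeomorph_source hf' hn
  -- Shrinking the source to the points with invertible derivative makes the local inverse smooth on
  -- its whole target, not only at the image of `a`.
  have hopen : IsOpen {x | (fderiv ℝ f x).IsInvertible} := by
    rw [isOpen_iff_mem_nhds]
    rintro x ⟨g, hg⟩
    have hc : ContinuousAt (fderiv ℝ f) x := (hf.continuous_fderiv hn).continuousAt
    have := hc.preimage_mem_nhds (by rw [← hg]; exact g.nhds)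
    filter_upwards [this] with y hy
    obtain ⟨g', hg'⟩ := hy
    exact ⟨g', hg'⟩
  let e := e₀.restrOpen _ hopen
  have hsrc : e.source = e₀.source ∩ {x | (fderiv ℝ f x).IsInvertible} :=
    OpenPartialHomeomorph.restrOpen_source _ _ _
  have hcoe : ⇑e = f := he₀
  refine ⟨e, ?_, hcoe, ?_, ?_⟩
  · rw [hsrc]
    exact ⟨ha₀, ⟨f', hf'.fderiv.symm⟩⟩
  · intro y hy
    have hx : e.symm y ∈ e.source := e.map_target hy
    rw [hsrc] at hx
    obtain ⟨g, hg⟩ := hx.2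
    refine (e.contDiffAt_symm hy (f₀' := g) ?_ ?_).contDiffWithinAt
    · rw [hcoe, hg]
      exact (hf.differentiable hn _).hasFDerivAt
    · rw [hcoe]
      exact hf.contDiffAt
  · intro x hx
    rw [hsrc] at hx
    exact hx.2

/-- A function that is smooth near a point agrees near this point with a smooth function. -/
theorem exists_contDiff_eventuallyEq {V F : Type*} [NormedAddCommGroup V] [NormedSpace ℝ V]
    [FiniteDimensional ℝ V] [NormedAddCommGroup F] [NormedSpace ℝ F] {f : V → F} {a : V}
    (hf : ∀ᶠ x in 𝓝 a, ContDiffAt ℝ ∞ f x) :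
    ∃ g : V → F, ContDiff ℝ ∞ g ∧ g =ᶠ[𝓝 a] f := by
  obtain ⟨r, hr, hball⟩ := Metric.eventually_nhds_iff_ball.1 hf
  let χ : ContDiffBump a := ⟨r / 3, r / 2, by positivity, by linarith⟩
  refine ⟨fun x => χ x • f x, ?_, ?_⟩
  · rw [contDiff_iff_contDiffAt]
    intro x
    by_cases hx : x ∈ Metric.ball a r
    · exact χ.contDiffAt.smul (hball x hx)
    · have hxs : x ∉ tsupport χ := by
        rw [χ.tsupport_eq]
        intro h
        exact hx (Metric.closedBall_subset_ball (by change r / 2 < r; linarith) h)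
      have : (fun x => χ x • f x) =ᶠ[𝓝 x] fun _ => 0 := by
        filter_upwards [notMem_tsupport_iff_eventuallyEq.1 hxs] with y hy
        rw [hy]
        simp
      exact contDiffAt_const.congr_of_eventuallyEq this
  · filter_upwards [χ.eventuallyEq_one] with x hx
    rw [hx]
    simp

end Calculus

/-! ### Smoothness of superposition operators on spaces of continuous maps -/

section Superposition

universe u

variable {K : Type*} [TopologicalSpace K] [CompactSpace K]
  {E : Type u} [NormedAddCommGroup E] [NormedSpace ℝ E]
  {F : Type u} [NormedAddCommGroup F] [NormedSpace ℝ F]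

/-- A bounded bilinear map, applied pointwise to continuous functions. -/
def pointwiseBilin {G : Type*} [NormedAddCommGroup G] [NormedSpace ℝ G] (B : G →L[ℝ] E →L[ℝ] F) :
    C(K, G) →L[ℝ] C(K, E) →L[ℝ] C(K, F) :=
  LinearMap.mkContinuous₂
    (LinearMap.mk₂ ℝ (fun (A : C(K, G)) (u : C(K, E)) =>
        (⟨fun t => B (A t) (u t),
          (B.continuous.comp A.continuous).clm_apply u.continuous⟩ : C(K, F)))
      (fun A A' u => by ext t; exact congrArg (· (u t)) (map_add B (A t) (A' t)))
      (fun c A u => by ext t; exact congrArg (· (u t)) (map_smul B c (A t)))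
      (fun A u v => by ext t; exact map_add (B (A t)) (u t) (v t))
      (fun c A u => by ext t; exact map_smul (B (A t)) c (u t))) ‖B‖
    (fun A u => by
      rw [ContinuousMap.norm_le _ (by positivity)]
      intro t
      exact (B.le_opNorm₂ (A t) (u t)).trans
        (mul_le_mul (mul_le_mul_of_nonneg_left (A.norm_coe_le_norm t) (by positivity))
          (u.norm_coe_le_norm t) (by positivity) (by positivity)))

theorem contDiff_pointwiseBilin {G : Type*} [NormedAddCommGroup G] [NormedSpace ℝ G]
    (B : G →L[ℝ] E →L[ℝ] F) {P : Type*} [NormedAddCommGroup P] [NormedSpace ℝ P]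
    {g : P → C(K, G)} {n : WithTop ℕ∞} (hg : ContDiff ℝ n g) :
    ContDiff ℝ n (fun p => pointwiseBilin B (g p)) :=
  (pointwiseBilin (K := K) B).contDiff.comp hg

/-- Pointwise application of a family of operators, as an operator on `C(K, E)`. -/
def pointwiseApply : C(K, E →L[ℝ] F) →L[ℝ] C(K, E) →L[ℝ] C(K, F) :=
  pointwiseBilin (ContinuousLinearMap.id ℝ (E →L[ℝ] F))

theorem pointwiseApply_apply (A : C(K, E →L[ℝ] F)) (u : C(K, E)) (t : K) :
    pointwiseApply A u t = A t (u t) := rfl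

/-- The superposition operator `u ↦ v ∘ u` on `C(K, E)`. -/
def superposition (v : C(E, F)) (u : C(K, E)) : C(K, F) := v.comp u

/-- The range of `u` is compact, so `v'` is uniformly continuous near it. The mean value inequality
then bounds the Taylor remainder at all `t` simultaneously, which is the bound in the sup norm. -/
theorem hasFDerivAt_superposition (v : C(E, F)) (v' : C(E, E →L[ℝ] F))
    (hv : ∀ x, HasFDerivAt v (v' x) x) (u : C(K, E)) :
    HasFDerivAt (superposition (K := K) v) (pointwiseApply (superposition v' u)) u := by
  rw [hasFDerivAt_iff_isLittleO_nhds_zero, Asymptotics.isLittleO_iff]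
  intro ε hε
  have hunif := (isCompact_range u.continuous).uniformContinuousAt_of_continuousAt v'
    (fun x _ => v'.continuous.continuousAt) (Metric.dist_mem_uniformity hε)
  obtain ⟨δ, hδ, hδ'⟩ := Metric.mem_uniformity_dist.1 hunif
  filter_upwards [Metric.ball_mem_nhds (0 : C(K, E)) hδ] with h hh
  rw [mem_ball_zero_iff] at hh
  rw [ContinuousMap.norm_le _ (by positivity)]
  intro t
  have hseg : ∀ y ∈ segment ℝ (u t) (u t + h t), ‖v' y - v' (u t)‖ ≤ ε := by
    intro y hy
    have hy' : dist (u t) y < δ := by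
      have := (convex_closedBall (u t) ‖h t‖).segment_subset
        (Metric.mem_closedBall_self (norm_nonneg _))
        (by rw [Metric.mem_closedBall, dist_eq_norm]; simp) hy
      rw [Metric.mem_closedBall, dist_comm] at this
      exact this.trans_lt ((h.norm_coe_le_norm t).trans_lt hh)
    have := hδ' hy' (mem_range_self t)
    rw [← dist_eq_norm, dist_comm]
    exact le_of_lt this
  have := (convex_segment (u t) (u t + h t)).norm_image_sub_le_of_norm_hasFDerivWithin_le'
    (fun y _ => (hv y).hasFDerivWithinAt) hseg (left_mem_segment ℝ _ _) (right_mem_segment ℝ _ _)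
  rw [add_sub_cancel_left] at this
  exact this.trans (mul_le_mul_of_nonneg_left (h.norm_coe_le_norm t) hε.le)

/-- Induction on the order of differentiability, with `F` varying: the derivative is a bounded
linear map applied to the superposition operator of `fderiv ℝ v`, whose values are operators. The
common universe of `E` and `F` is what allows `F` to be replaced by `E →L[ℝ] F`. -/
theorem contDiff_superposition {v : E → F} (hv : ContDiff ℝ ∞ v) :
    ContDiff ℝ ∞ (superposition (K := K) ⟨v, hv.continuous⟩) := by
  rw [contDiff_infty]
  intro n
  induction n generalizing F with
  | zero =>
    exact contDiff_zero.2 (ContinuousMap.continuous_postcomp _)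
  | succ n ih =>
    have hv' : ContDiff ℝ ∞ (fderiv ℝ v) := hv.fderiv_right (by simp)
    rw [Nat.cast_succ, contDiff_succ_iff_hasFDerivAt]
    exact ⟨fun u => pointwiseApply (superposition ⟨fderiv ℝ v, hv'.continuous⟩ u),
      contDiff_pointwiseBilin _ (ih hv'),
      fun u => hasFDerivAt_superposition _ ⟨fderiv ℝ v, hv'.continuous⟩
        (fun x => (hv.differentiable (by simp) x).hasFDerivAt) u⟩

end Superposition

/-! ### Smooth local flows from the inverse function theorem on path space -/

section Flow

variable {E : Type*} [NormedAddCommGroup E] [NormedSpace ℝ E]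

/-- The primitive vanishing at `0` of a continuous path. -/
def primitive : C(unitInterval, E) →L[ℝ] C(unitInterval, E) :=
  LinearMap.mkContinuous
    { toFun := fun u => ⟨fun t => ∫ s in (0 : ℝ)..t, u (projIcc 0 1 zero_le_one s),
        (intervalIntegral.continuous_primitive (fun a b =>
          (u.continuous.comp continuous_projIcc).intervalIntegrable a b) 0).comp
            continuous_subtype_val⟩
      map_add' := fun u w => by
        ext t
        exact intervalIntegral.integral_add
          ((u.continuous.comp continuous_projIcc).intervalIntegrable _ _)
          ((w.continuous.comp continuous_projIcc).intervalIntegrable _ _)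
      map_smul' := fun c u => by
        ext t
        exact intervalIntegral.integral_smul _ _ } 1
    (fun u => by
      rw [ContinuousMap.norm_le _ (by positivity)]
      intro t
      have := intervalIntegral.norm_integral_le_of_norm_le_const (a := (0 : ℝ)) (b := t)
        (f := fun s => u (projIcc 0 1 zero_le_one s)) (C := ‖u‖)
        (fun s _ => u.norm_coe_le_norm _)
      refine this.trans ?_
      rw [sub_zero, abs_of_nonneg t.2.1, mul_comm]
      exact mul_le_mul_of_nonneg_right t.2.2 (norm_nonneg _))

theorem primitive_apply (u : C(unitInterval, E)) (t : unitInterval) :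
    primitive u t = ∫ s in (0 : ℝ)..t, u (projIcc 0 1 zero_le_one s) := rfl

end Flow

section Flow

variable {E : Type*} [NormedAddCommGroup E] [NormedSpace ℝ E]

/-- The constant path, as an operator. -/
def constPath : E →L[ℝ] C(unitInterval, E) :=
  LinearMap.mkContinuous
    { toFun := fun x => ContinuousMap.const _ x
      map_add' := fun _ _ => rfl
      map_smul' := fun _ _ => rfl } 1
    (fun x => by
      rw [ContinuousMap.norm_le _ (by positivity)]
      intro t
      rw [one_mul]
      exact le_rfl)

/-- The zeros of the last component are the solutions on `[0, 1]` of `u' = c v(u)`, `u(0) = x`. -/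
def flowEquation (v : C(E, E)) (p : ℝ × E × C(unitInterval, E)) : ℝ × E × C(unitInterval, E) :=
  (p.1, p.2.1, p.2.2 - constPath p.2.1 - p.1 • primitive (superposition v p.2.2))

variable {v : E → E} (hv : ContDiff ℝ ∞ v)

include hv in
theorem contDiff_flowEquation : ContDiff ℝ ∞ (flowEquation ⟨v, hv.continuous⟩) := by
  have h1 : ContDiff ℝ ∞ (fun p : ℝ × E × C(unitInterval, E) =>
      primitive (superposition ⟨v, hv.continuous⟩ p.2.2)) :=
    primitive.contDiff.comp ((contDiff_superposition hv).comp (contDiff_snd.comp contDiff_snd))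
  have h2 : ContDiff ℝ ∞ (fun p : ℝ × E × C(unitInterval, E) => constPath p.2.1) :=
    (constPath (E := E)).contDiff.comp (contDiff_fst.comp contDiff_snd)
  exact contDiff_fst.prodMk ((contDiff_fst.comp contDiff_snd).prodMk
    (((contDiff_snd.comp contDiff_snd).sub h2).sub (contDiff_fst.smul h1)))

/-- The derivative of `flowEquation`. -/
def flowEquationDeriv (p : ℝ × E × C(unitInterval, E)) :
    ℝ × E × C(unitInterval, E) →L[ℝ] ℝ × E × C(unitInterval, E) :=
  (ContinuousLinearMap.fst ℝ _ _).prod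
    (((ContinuousLinearMap.fst ℝ _ _).comp (ContinuousLinearMap.snd ℝ _ _)).prod
      ((ContinuousLinearMap.snd ℝ _ _).comp (ContinuousLinearMap.snd ℝ _ _) -
        constPath.comp ((ContinuousLinearMap.fst ℝ _ _).comp (ContinuousLinearMap.snd ℝ _ _)) -
        (p.1 • (primitive.comp
            (pointwiseApply (superposition ⟨fderiv ℝ v, hv.continuous_fderiv (by simp)⟩ p.2.2))).comp
          ((ContinuousLinearMap.snd ℝ _ _).comp (ContinuousLinearMap.snd ℝ _ _)) +
        (ContinuousLinearMap.fst ℝ _ _).smulRight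
          (primitive (superposition ⟨v, hv.continuous⟩ p.2.2)))))

theorem hasFDerivAt_flowEquation (p : ℝ × E × C(unitInterval, E)) :
    HasFDerivAt (flowEquation ⟨v, hv.continuous⟩) (flowEquationDeriv hv p) p := by
  have hs := hasFDerivAt_superposition ⟨v, hv.continuous⟩
    ⟨fderiv ℝ v, hv.continuous_fderiv (by simp)⟩
    (fun x => (hv.differentiable (by simp) x).hasFDerivAt) p.2.2
  have hsnd : HasFDerivAt (fun p : ℝ × E × C(unitInterval, E) => p.2.2)
      ((ContinuousLinearMap.snd ℝ _ _).comp (ContinuousLinearMap.snd ℝ _ _)) p :=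
    ((ContinuousLinearMap.snd ℝ E C(unitInterval, E)).comp
      (ContinuousLinearMap.snd ℝ ℝ (E × C(unitInterval, E)))).hasFDerivAt
  have hmid : HasFDerivAt (fun p : ℝ × E × C(unitInterval, E) => p.2.1)
      ((ContinuousLinearMap.fst ℝ _ _).comp (ContinuousLinearMap.snd ℝ _ _)) p :=
    ((ContinuousLinearMap.fst ℝ E C(unitInterval, E)).comp
      (ContinuousLinearMap.snd ℝ ℝ (E × C(unitInterval, E)))).hasFDerivAt
  have h1 := primitive.hasFDerivAt.comp p (hs.comp p hsnd)
  have h2 := (constPath (E := E)).hasFDerivAt.comp p hmid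
  exact hasFDerivAt_fst.prodMk (hmid.prodMk ((hsnd.sub h2).sub (hasFDerivAt_fst.smul h1)))

/-- At time scale `0` the term with the derivative of `v` drops out. What remains is unipotent
triangular, and its inverse is found by reversing the signs of the off-diagonal terms. -/
theorem isInvertible_flowEquationDeriv (x : E) (u : C(unitInterval, E)) :
    (flowEquationDeriv hv (0, x, u)).IsInvertible := by
  let w := primitive (superposition ⟨v, hv.continuous⟩ u)
  let g : ℝ × E × C(unitInterval, E) →L[ℝ] ℝ × E × C(unitInterval, E) :=
    (ContinuousLinearMap.fst ℝ _ _).prod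
    (((ContinuousLinearMap.fst ℝ _ _).comp (ContinuousLinearMap.snd ℝ _ _)).prod
      ((ContinuousLinearMap.snd ℝ _ _).comp (ContinuousLinearMap.snd ℝ _ _) +
        constPath.comp ((ContinuousLinearMap.fst ℝ _ _).comp (ContinuousLinearMap.snd ℝ _ _)) +
        (ContinuousLinearMap.fst ℝ _ _).smulRight w))
  have hf : ∀ q : ℝ × E × C(unitInterval, E), flowEquationDeriv hv (0, x, u) q =
      (q.1, q.2.1, q.2.2 - constPath q.2.1 - q.1 • w) := fun q => by
    simp [flowEquationDeriv, w]
  have hg : ∀ q : ℝ × E × C(unitInterval, E), g q =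
      (q.1, q.2.1, q.2.2 + constPath q.2.1 + q.1 • w) := fun q => by
    simp [g]
  refine ⟨ContinuousLinearEquiv.equivOfInverse (flowEquationDeriv hv (0, x, u)) g ?_ ?_, rfl⟩
  · intro q
    rw [hf, hg]
    refine Prod.ext rfl (Prod.ext rfl ?_)
    dsimp only
    abel
  · intro q
    rw [hg, hf]
    refine Prod.ext rfl (Prod.ext rfl ?_)
    dsimp only
    abel

/-- Since `projIcc` extends the path to `ℝ` by constants, the derivative is two-sided even at the
endpoints of `[0, 1]`. -/
theorem hasDerivAt_primitive [CompleteSpace E] (u : C(unitInterval, E)) (t : ℝ) :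
    HasDerivAt (fun t => ∫ s in (0 : ℝ)..t, u (projIcc 0 1 zero_le_one s))
      (u (projIcc 0 1 zero_le_one t)) t := by
  have hc : Continuous fun s : ℝ => u (projIcc 0 1 zero_le_one s) :=
    u.continuous.comp continuous_projIcc
  exact intervalIntegral.integral_hasDerivAt_right (hc.intervalIntegrable _ _)
    hc.stronglyMeasurable.stronglyMeasurableAtFilter hc.continuousAt

/-- The variation of a solution with respect to the time scale. -/
theorem flowEquationDeriv_variation [CompleteSpace E] (p : ℝ × E × C(unitInterval, E))
    (hp : (flowEquation ⟨v, hv.continuous⟩ p).2.2 = 0) :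
    ∃ w : C(unitInterval, E), w 1 = v (p.2.2 1) ∧ flowEquationDeriv hv p (1, 0, w) = (1, 0, 0) := by
  obtain ⟨c, x, u⟩ := p
  let N : C(unitInterval, E) := superposition ⟨v, hv.continuous⟩ u
  let N' : C(unitInterval, E →L[ℝ] E) :=
    superposition ⟨fderiv ℝ v, hv.continuous_fderiv (by simp)⟩ u
  -- The path with time scale `c` is, heuristically, `t ↦ flow of v for time c t`. Its derivative in
  -- `c` is `t v(u(t))`.
  let w : C(unitInterval, E) := ⟨fun t => (t : ℝ) • N t, by fun_prop⟩
  let U : ℝ → E := fun t => x + c • ∫ s in (0 : ℝ)..t, N (projIcc 0 1 zero_le_one s)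
  have hU : ∀ t, HasDerivAt U (c • N (projIcc 0 1 zero_le_one t)) t := fun t =>
    ((hasDerivAt_primitive N t).const_smul c).const_add x
  have hUu : ∀ t : unitInterval, U t = u t := fun t => by
    have h : u t - x - c • primitive N t = 0 := congrArg (fun z : C(unitInterval, E) => z t) hp
    rw [primitive_apply] at h
    rw [sub_sub, sub_eq_zero] at h
    exact h.symm
  refine ⟨w, ?_, ?_⟩
  · change ((1 : unitInterval) : ℝ) • N 1 = _
    rw [Set.Icc.coe_one, one_smul]
    rfl
  -- The linearized equation, integrated from the product rule for `s ↦ s v(U s)`, where `U' = c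
  -- v(U)`.
  have key : w - (c • primitive (pointwiseApply N' w) + primitive N) = 0 := by
    ext t
    change w t - (c • primitive (pointwiseApply N' w) t + primitive N t) = 0
    rw [sub_eq_zero, primitive_apply, primitive_apply, ← intervalIntegral.integral_smul,
      ← intervalIntegral.integral_add]
    · have hd : ∀ s ∈ uIcc (0 : ℝ) t, HasDerivAt (fun s => s • v (U s))
          (c • pointwiseApply N' w (projIcc 0 1 zero_le_one s) +
            N (projIcc 0 1 zero_le_one s)) s := by
        intro s hs
        rw [uIcc_of_le t.2.1] at hs
        have hs' : s ∈ Icc (0 : ℝ) 1 := ⟨hs.1, hs.2.trans t.2.2⟩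
        have h1 := ((hv.differentiable (by simp) (U s)).hasFDerivAt.comp_hasDerivAt s (hU s))
        have h2 := (hasDerivAt_id s).smul h1
        convert! h2 using 1
        rw [projIcc_of_mem zero_le_one hs', pointwiseApply_apply]
        change c • (fderiv ℝ v (u ⟨s, hs'⟩)) (s • N ⟨s, hs'⟩) + v (u ⟨s, hs'⟩) = _
        rw [← hUu ⟨s, hs'⟩]
        simp only [id_eq, map_smul, one_smul]
        rw [smul_comm]
        rfl
      rw [intervalIntegral.integral_eq_sub_of_hasDerivAt hd]
      · rw [zero_smul, sub_zero, hUu]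
        rfl
      · refine Continuous.intervalIntegrable ?_ _ _
        exact (((pointwiseApply N' w).continuous.comp continuous_projIcc).const_smul c).add
          (N.continuous.comp continuous_projIcc)
    · exact (((pointwiseApply N' w).continuous.comp
        continuous_projIcc).const_smul c).intervalIntegrable _ _
    · exact (N.continuous.comp continuous_projIcc).intervalIntegrable _ _
  have hf : flowEquationDeriv hv (c, x, u) (1, 0, w) = (1, 0, w - (c • primitive
      (pointwiseApply N' w) + primitive N)) := by
    simp [flowEquationDeriv, N, N']
  rw [hf, key]

/-- A smooth vector field has a smooth local flow. -/
theorem exists_smooth_flow [CompleteSpace E] (hv : ContDiff ℝ ∞ v) (x₀ : E) :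
    ∃ Φ : ℝ × E → E, (∀ᶠ p in 𝓝 (0, x₀), ContDiffAt ℝ ∞ Φ p) ∧ (∀ᶠ x in 𝓝 x₀, Φ (0, x) = x) ∧
      ∀ᶠ p in 𝓝 ((0 : ℝ), x₀), HasDerivAt (fun t => Φ (t, p.2)) (v (Φ p)) p.1 := by
  let H := flowEquation ⟨v, hv.continuous⟩
  obtain ⟨g, hg⟩ := isInvertible_flowEquationDeriv hv x₀ (constPath x₀)
  obtain ⟨e, hsrc, hcoe, hsmooth, hinv⟩ := exists_smooth_localInverse (contDiff_flowEquation hv)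
    (0, x₀, constPath x₀) g (by rw [hg]; exact hasFDerivAt_flowEquation hv _)
  have hH0 : H (0, x₀, constPath x₀) = (0, x₀, 0) := by
    simp [H, flowEquation]
  let J : ℝ × E → ℝ × E × C(unitInterval, E) := fun p => (p.1, p.2, 0)
  have hJ : ContDiff ℝ ∞ J := contDiff_fst.prodMk (contDiff_snd.prodMk contDiff_const)
  let O : Set (ℝ × E) := J ⁻¹' e.target
  have hO : IsOpen O := e.open_target.preimage hJ.continuous
  have hO0 : ((0 : ℝ), x₀) ∈ O := by
    change (0, x₀, 0) ∈ e.target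
    rw [← hH0]
    have := e.map_source hsrc
    rwa [hcoe] at this
  let Q : ℝ × E → ℝ × E × C(unitInterval, E) := fun p => e.symm (J p)
  have hQ : ∀ p ∈ O, ContDiffAt ℝ ∞ Q p := fun p hp =>
    (hsmooth.contDiffAt (e.open_target.mem_nhds hp)).comp p hJ.contDiffAt
  have hHQ : ∀ p ∈ O, H (Q p) = J p := fun p hp => by
    have := e.right_inv hp
    rwa [hcoe] at this
  have hQ1 : ∀ p ∈ O, (Q p).1 = p.1 := fun p hp => congrArg Prod.fst (hHQ p hp)
  have hQ2 : ∀ p ∈ O, (Q p).2.1 = p.2 := fun p hp => congrArg (fun z => z.2.1) (hHQ p hp)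
  have hQ3 : ∀ p ∈ O, (H (Q p)).2.2 = 0 := fun p hp => by rw [hHQ p hp]
  -- The flow at time `t` is the endpoint of the solution path with time scale `t`.
  let ev : ℝ × E × C(unitInterval, E) →L[ℝ] E :=
    (ContinuousMap.evalCLM ℝ (1 : unitInterval)).comp
      ((ContinuousLinearMap.snd ℝ _ _).comp (ContinuousLinearMap.snd ℝ _ _))
  refine ⟨fun p => ev (Q p), ?_, ?_, ?_⟩
  · filter_upwards [hO.mem_nhds hO0] with p hp
    exact ev.contDiff.contDiffAt.comp p (hQ p hp)
  · have hc : ContinuousAt (fun x : E => ((0 : ℝ), x)) x₀ := by fun_prop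
    filter_upwards [hc.preimage_mem_nhds (hO.mem_nhds hO0)] with x hx
    have h3 := hQ3 _ hx
    change (Q (0, x)).2.2 - constPath (Q (0, x)).2.1 -
      (Q (0, x)).1 • primitive (superposition _ (Q (0, x)).2.2) = 0 at h3
    rw [hQ1 _ hx, hQ2 _ hx, zero_smul, sub_zero, sub_eq_zero] at h3
    exact congrArg (fun z : C(unitInterval, E) => z 1) h3
  · filter_upwards [hO.mem_nhds hO0] with p hp
    have hl : HasDerivAt (fun t : ℝ => (t, p.2)) ((1 : ℝ), (0 : E)) p.1 :=
      (hasDerivAt_id _).prodMk (hasDerivAt_const _ _)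
    have hQd := ((hQ p hp).differentiableAt (by simp)).hasFDerivAt
    have hd : HasDerivAt (fun t => Q (t, p.2)) (fderiv ℝ Q p (1, 0)) p.1 :=
      HasFDerivAt.comp_hasDerivAt (l := Q) p.1 hQd hl
    have h1 := (hasFDerivAt_flowEquation hv (Q p)).comp_hasDerivAt p.1 hd
    have h2 : HasDerivAt (fun t => J (t, p.2)) ((1 : ℝ), (0 : E), (0 : C(unitInterval, E))) p.1 :=
      (hasDerivAt_id _).prodMk ((hasDerivAt_const _ _).prodMk (hasDerivAt_const _ _))
    have hev : (fun t => J (t, p.2)) =ᶠ[𝓝 p.1] fun t => H (Q (t, p.2)) := by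
      have hc : ContinuousAt (fun t : ℝ => (t, p.2)) p.1 := by fun_prop
      filter_upwards [hc.preimage_mem_nhds (hO.mem_nhds hp)] with t ht
      exact (hHQ _ ht).symm
    have h3 := h1.unique (h2.congr_of_eventuallyEq hev.symm)
    obtain ⟨w, hw1, hw⟩ := flowEquationDeriv_variation hv (Q p) (hQ3 p hp)
    -- The time derivative of `Q` and the explicit variation `(1, 0, w)` have the same image under
    -- an injective operator, so they coincide. Evaluating at the endpoint gives the differential
    -- equation for the flow.
    have hinj : Function.Injective (flowEquationDeriv hv (Q p)) := by
      have hs : Q p ∈ e.source := e.map_target hp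
      obtain ⟨g', hg'⟩ := hinv _ hs
      rw [← (hasFDerivAt_flowEquation hv (Q p)).fderiv, ← hg']
      exact g'.injective
    have h4 := hinj (h3.trans hw.symm)
    have h5 := (ev.hasFDerivAt (x := Q p)).comp_hasDerivAt p.1 hd
    rw [h4] at h5
    convert! h5 using 1
    exact hw1.symm

end Flow

/-! ### One-forms, Hamiltonian fields and a transversal Grönwall argument on normed spaces -/

section OneForms

variable {V W : Type*} [NormedAddCommGroup V] [NormedSpace ℝ V] [NormedAddCommGroup W]
  [NormedSpace ℝ W]

/-- The exterior derivative of a `1`-form on a normed space. -/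
def extD (α : V → V →L[ℝ] ℝ) (x u v : V) : ℝ := fderiv ℝ α x u v - fderiv ℝ α x v u

/-- The pullback of a `1`-form. -/
def pullForm (j : W → V) (α : V → V →L[ℝ] ℝ) (x : W) : W →L[ℝ] ℝ := (α (j x)).comp (fderiv ℝ j x)

theorem extD_self (α : V → V →L[ℝ] ℝ) (x u : V) : extD α x u u = 0 := sub_self _

theorem extD_swap (α : V → V →L[ℝ] ℝ) (x u v : V) : extD α x u v = -extD α x v u := by
  simp only [extD]
  ring

theorem extD_add_left (α : V → V →L[ℝ] ℝ) (x u u' v : V) :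
    extD α x (u + u') v = extD α x u v + extD α x u' v := by
  simp only [extD, map_add, add_apply]
  ring

theorem extD_smul_left (α : V → V →L[ℝ] ℝ) (x : V) (c : ℝ) (u v : V) :
    extD α x (c • u) v = c * extD α x u v := by
  simp only [extD, map_smul, smul_apply, smul_eq_mul]
  ring

theorem extD_add_right (α : V → V →L[ℝ] ℝ) (x u v v' : V) :
    extD α x u (v + v') = extD α x u v + extD α x u v' := by
  rw [extD_swap, extD_add_left, extD_swap α x v, extD_swap α x v']
  ring

theorem extD_smul_right (α : V → V →L[ℝ] ℝ) (x : V) (c : ℝ) (u v : V) :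
    extD α x u (c • v) = c * extD α x u v := by
  rw [extD_swap, extD_smul_left, extD_swap α x v]
  ring

theorem extD_congr {α β : V → V →L[ℝ] ℝ} {x : V} (h : α =ᶠ[𝓝 x] β) (u v : V) :
    extD α x u v = extD β x u v := by
  simp only [extD, h.fderiv_eq]

theorem contDiffAt_pullForm {j : W → V} {α : V → V →L[ℝ] ℝ} {x : W}
    (hj : ContDiffAt ℝ ∞ j x) (hα : ContDiffAt ℝ ∞ α (j x)) : ContDiffAt ℝ ∞ (pullForm j α) x :=
  (hα.comp x hj).clm_comp (hj.fderiv_right (by simp))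

theorem contDiff_pullForm {j : W → V} {α : V → V →L[ℝ] ℝ}
    (hj : ContDiff ℝ ∞ j) (hα : ContDiff ℝ ∞ α) : ContDiff ℝ ∞ (pullForm j α) :=
  contDiff_iff_contDiffAt.2 fun _ => contDiffAt_pullForm hj.contDiffAt hα.contDiffAt

/-- The exterior derivative commutes with pullbacks. -/
theorem extD_pullForm {j : W → V} {α : V → V →L[ℝ] ℝ} {x : W}
    (hj : ContDiffAt ℝ ∞ j x) (hα : DifferentiableAt ℝ α (j x)) (u v : W) :
    extD (pullForm j α) x u v = extD α (j x) (fderiv ℝ j x u) (fderiv ℝ j x v) := by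
  have h1 : HasFDerivAt (fun y => α (j y)) ((fderiv ℝ α (j x)).comp (fderiv ℝ j x)) x :=
    hα.hasFDerivAt.comp x (hj.differentiableAt (by simp)).hasFDerivAt
  have hj' : ContDiffAt ℝ 1 (fderiv ℝ j) x := hj.fderiv_right (by
    rw [one_add_one_eq_two]
    exact WithTop.coe_le_coe.2 (le_top : (2 : ℕ∞) ≤ ⊤))
  have h2 := h1.clm_comp (hj'.differentiableAt (by simp)).hasFDerivAt
  -- The second derivatives of `j` cancel on antisymmetrization.
  have hsymm : IsSymmSndFDerivAt ℝ j x := hj.isSymmSndFDerivAt (by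
    rw [minSmoothness_of_isRCLikeNormedField]
    exact WithTop.coe_le_coe.2 (le_top : (2 : ℕ∞) ≤ ⊤))
  have h3 : fderiv ℝ (pullForm j α) x = _ := h2.fderiv
  simp only [extD, h3]
  simp [hsymm.eq u v]

/-- A `1`-form is contact at a point. -/
structure IsContactAt (α : V → V →L[ℝ] ℝ) (p : V) : Prop where
  ne_zero : α p ≠ 0
  nondegenerate : ∀ u, α p u = 0 → (∀ v, α p v = 0 → extD α p u v = 0) → u = 0

/-- The coefficients `c` and `c'` may differ, because nondegeneracy is tested only on `ker α`, where
the terms containing them vanish. -/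
theorem IsContactAt.hamiltonian_unique {α : V → V →L[ℝ] ℝ} {p : V} (h : IsContactAt α p)
    (ℓ : V →L[ℝ] ℝ) {Y Y' : V} {c c' : ℝ} (hY : α p Y = 0)
    (hYv : ∀ v, extD α p Y v = ℓ v - c * α p v) (hY' : α p Y' = 0)
    (hYv' : ∀ v, extD α p Y' v = ℓ v - c' * α p v) : Y = Y' := by
  rw [← sub_eq_zero]
  have hsub : Y - Y' = Y + (-1 : ℝ) • Y' := by rw [neg_one_smul, sub_eq_add_neg]
  refine h.nondegenerate _ (by rw [map_sub, hY, hY', sub_zero]) fun v hv => ?_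
  rw [hsub, extD_add_left, extD_smul_left, hYv, hYv', hv]
  ring

/-- The operator `u ↦ u ⌟ dα + α(u) α`. -/
def contactOperator (α : V → V →L[ℝ] ℝ) (x : V) : V →L[ℝ] V →L[ℝ] ℝ :=
  fderiv ℝ α x + (-1 : ℝ) • (fderiv ℝ α x).flip + (α x).smulRight (α x)

theorem contactOperator_apply (α : V → V →L[ℝ] ℝ) (x u v : V) :
    contactOperator α x u v = extD α x u v + α x u * α x v := by
  simp [contactOperator, extD, sub_eq_add_neg]

/-- Evaluating the image of `u` on `u` itself leaves `α(u)²`. A kernel vector is therefore a contact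
vector orthogonal to everything, hence zero, and a dimension count does the rest. -/
theorem IsContactAt.isInvertible [FiniteDimensional ℝ V] {α : V → V →L[ℝ] ℝ} {p : V}
    (h : IsContactAt α p) : (contactOperator α p).IsInvertible := by
  have hinj : Function.Injective (contactOperator α p) := by
    rw [injective_iff_map_eq_zero]
    intro u hu
    have hu' : ∀ v, extD α p u v + α p u * α p v = 0 := fun v => by
      rw [← contactOperator_apply, hu]
      rfl
    have h0 : α p u = 0 := by
      have := hu' u
      rw [extD_self, zero_add] at this
      exact mul_self_eq_zero.1 this
    refine h.nondegenerate u h0 fun v _ => ?_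
    have := hu' v
    rwa [h0, zero_mul, add_zero] at this
  have hrank : finrank ℝ V = finrank ℝ (V →L[ℝ] ℝ) := by
    rw [← (LinearMap.toContinuousLinearMap : (V →ₗ[ℝ] ℝ) ≃ₗ[ℝ] (V →L[ℝ] ℝ)).finrank_eq]
    exact (Subspace.dual_finrank_eq (K := ℝ) (V := V)).symm
  exact ⟨(LinearEquiv.ofInjectiveOfFinrankEq (contactOperator α p : V →ₗ[ℝ] V →L[ℝ] ℝ) hinj
    hrank).toContinuousLinearEquiv, rfl⟩

/-- The Hamiltonian field of a function is smooth. -/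
theorem IsContactAt.exists_hamiltonianField [FiniteDimensional ℝ V] {α : V → V →L[ℝ] ℝ} {p : V}
    (h : IsContactAt α p) (hα : ContDiff ℝ ∞ α) {f : V → ℝ} (hf : ContDiff ℝ ∞ f) :
    ∃ (Y : V → V) (c : V → ℝ), ContDiff ℝ ∞ Y ∧ ContDiff ℝ ∞ c ∧
      ∀ᶠ x in 𝓝 p, α x (Y x) = 0 ∧ ∀ v, extD α x (Y x) v = fderiv ℝ f x v - c x * α x v := by
  have hα' : ContDiff ℝ ∞ (fderiv ℝ α) := hα.fderiv_right (by simp)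
  have hf' : ContDiff ℝ ∞ (fderiv ℝ f) := hf.fderiv_right (by simp)
  have hB : ContDiff ℝ ∞ (contactOperator α) := by
    refine contDiff_clm_apply_iff.2 fun u => contDiff_clm_apply_iff.2 fun v => ?_
    simp only [contactOperator_apply, extD]
    exact (((hα'.clm_apply contDiff_const).clm_apply contDiff_const).sub
      ((hα'.clm_apply contDiff_const).clm_apply contDiff_const)).add
        ((hα.clm_apply contDiff_const).mul (hα.clm_apply contDiff_const))
  have hopen : ∀ᶠ x in 𝓝 p, (contactOperator α x).IsInvertible := by
    obtain ⟨g, hg⟩ := h.isInvertible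
    have := hB.continuous.continuousAt.preimage_mem_nhds
      (x := p) (by rw [← hg]; exact g.nhds)
    filter_upwards [this] with y hy
    obtain ⟨g', hg'⟩ := hy
    exact ⟨g', hg'⟩
  -- Near `p` this is the Reeb field: evaluating its equation on `Z` gives `α(Z)² = α(Z)`, so `α(Z)
  -- = 1` wherever `α(Z) ≠ 0`, and then `Z ⌟ dα = 0`. Subtracting `α(w) Z` from `w` gives the
  -- Hamiltonian field, with coefficient `c = α(w)`.
  let Z : V → V := fun x => (contactOperator α x).inverse (α x)
  let w : V → V := fun x => (contactOperator α x).inverse (fderiv ℝ f x)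
  have hinv : ∀ᶠ x in 𝓝 p, ContDiffAt ℝ ∞ (fun x => (contactOperator α x).inverse) x := by
    filter_upwards [hopen] with x hx
    obtain ⟨g, hg⟩ := hx
    have := contDiffAt_map_inverse (n := ∞) g
    rw [hg] at this
    exact this.comp x hB.contDiffAt
  have hZs : ∀ᶠ x in 𝓝 p, ContDiffAt ℝ ∞ Z x := by
    filter_upwards [hinv] with x hx using hx.clm_apply hα.contDiffAt
  have hws : ∀ᶠ x in 𝓝 p, ContDiffAt ℝ ∞ w x := by
    filter_upwards [hinv] with x hx using hx.clm_apply hf'.contDiffAt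
  have hBZ : ∀ᶠ x in 𝓝 p, ∀ v, extD α x (Z x) v + α x (Z x) * α x v = α x v := by
    filter_upwards [hopen] with x hx v
    rw [← contactOperator_apply, hx.self_apply_inverse]
  have hBw : ∀ᶠ x in 𝓝 p, ∀ v, extD α x (w x) v + α x (w x) * α x v = fderiv ℝ f x v := by
    filter_upwards [hopen] with x hx v
    rw [← contactOperator_apply, hx.self_apply_inverse]
  have hne : α p (Z p) ≠ 0 := by
    intro h0
    have hz := hBZ.self_of_nhds
    rw [h0] at hz
    simp only [zero_mul, add_zero] at hz
    have hZ0 : Z p = 0 := h.nondegenerate _ h0 fun v hv => by rw [hz, hv]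
    apply h.ne_zero
    ext v
    rw [← hz, hZ0]
    simp [extD]
  have hne' : ∀ᶠ x in 𝓝 p, α x (Z x) ≠ 0 :=
    (ContinuousAt.clm_apply hα.continuous.continuousAt
      hZs.self_of_nhds.continuousAt).eventually_ne hne
  have hone : ∀ᶠ x in 𝓝 p, α x (Z x) = 1 := by
    filter_upwards [hne', hBZ] with x hx hz
    have := hz (Z x)
    rw [extD_self, zero_add] at this
    exact mul_left_cancel₀ hx (by rw [this, mul_one])
  obtain ⟨Y, hY, hYe⟩ := exists_contDiff_eventuallyEq
    (f := fun x => w x - α x (w x) • Z x) (a := p) (by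
      filter_upwards [hZs, hws] with x hz hw
      exact hw.sub ((hα.contDiffAt.clm_apply hw).smul hz))
  obtain ⟨c, hc, hce⟩ := exists_contDiff_eventuallyEq (f := fun x => α x (w x)) (a := p) (by
      filter_upwards [hws] with x hw
      exact hα.contDiffAt.clm_apply hw)
  refine ⟨Y, c, hY, hc, ?_⟩
  filter_upwards [hYe, hce, hone, hBZ, hBw] with x hYx hcx h1 hz hw
  have hsub : Y x = w x + (-α x (w x)) • Z x := by rw [hYx, neg_smul, sub_eq_add_neg]
  refine ⟨by rw [hsub]; simp [h1], fun v => ?_⟩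
  have hz' := hz v
  rw [h1, one_mul, add_eq_right] at hz'
  rw [hsub, extD_add_left, extD_smul_left, hz', hcx, ← hw v]
  ring

/-- A function which vanishes on the hyperplane `τ = 0` and is controlled by a linear differential
inequality in a transversal direction vanishes. -/
theorem eventually_eq_zero_of_transversal {F : Type*} [NormedAddCommGroup F] [NormedSpace ℝ F]
    {h : W → F} {τ : W →L[ℝ] ℝ} {w₀ : W} (hτ : τ w₀ = 1) {C : ℝ}
    (hh : ∀ᶠ w in 𝓝 (0 : W), DifferentiableAt ℝ h w ∧ ‖fderiv ℝ h w w₀‖ ≤ C * ‖h w‖ ∧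
      (τ w = 0 → h w = 0)) : ∀ᶠ w in 𝓝 (0 : W), h w = 0 := by
  -- The segment in direction `w₀` from the hyperplane `τ = 0`, at `s = 0`, to `w`, at `s = 1`.
  -- Compactness of `[0, 1]` keeps the whole segment in the good neighbourhood when `w` is near `0`,
  -- and Grönwall's inequality applies along it.
  let ρ : W → ℝ → W := fun w s => w + ((s - 1) * τ w) • w₀
  have hpath : ∀ᶠ w in 𝓝 (0 : W), ∀ s ∈ Icc (0 : ℝ) 1, DifferentiableAt ℝ h (ρ w s) ∧
      ‖fderiv ℝ h (ρ w s) w₀‖ ≤ C * ‖h (ρ w s)‖ ∧ (τ (ρ w s) = 0 → h (ρ w s) = 0) := by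
    refine isCompact_Icc.eventually_forall_of_forall_eventually fun s _ => ?_
    have hc : Filter.Tendsto (fun z : W × ℝ => ρ z.1 z.2) (𝓝 (0, s)) (𝓝 0) := by
      have : ContinuousAt (fun z : W × ℝ => ρ z.1 z.2) (0, s) := by
        dsimp only [ρ]
        fun_prop
      simpa [ContinuousAt, ρ] using this
    exact hc.eventually hh
  filter_upwards [hpath] with w hw
  have hρ : ∀ s, HasDerivAt (ρ w) (τ w • w₀) s := fun s => by
    have := ((((hasDerivAt_id s).sub_const 1).mul_const (τ w)).smul_const w₀).const_add w
    rwa [one_mul] at this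
  have hd : ∀ s ∈ Icc (0 : ℝ) 1, HasDerivAt (fun s => h (ρ w s))
      (τ w • fderiv ℝ h (ρ w s) w₀) s := fun s hs => by
    have := (hw s hs).1.hasFDerivAt.comp_hasDerivAt s (hρ s)
    rwa [map_smul] at this
  have h0 : h (ρ w 0) = 0 := (hw 0 ⟨le_rfl, zero_le_one⟩).2.2 (by simp [ρ, hτ])
  have := eq_zero_of_abs_deriv_le_mul_abs_self_of_eq_zero_right (K := |τ w| * C)
    (fun s hs => (hd s hs).continuousAt.continuousWithinAt)
    (fun s hs => (hd s (Ico_subset_Icc_self hs)).hasDerivWithinAt) h0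
    (fun s hs => by
      rw [norm_smul, mul_assoc]
      exact mul_le_mul_of_nonneg_left (hw s (Ico_subset_Icc_self hs)).2.1 (norm_nonneg _))
    1 ⟨zero_le_one, le_rfl⟩
  simpa [ρ] using this

end OneForms

/-! ### Flow-out of isotropic immersions and parametrization of levels -/

section IsotropicImmersions

variable {V W : Type*} [NormedAddCommGroup V] [NormedSpace ℝ V] [NormedAddCommGroup W]
  [NormedSpace ℝ W]

/-- The flow-out of an isotropic immersion `g` in a level of `f` along the Hamiltonian field of `f`
is isotropic and lies in the same level. -/
theorem exists_flowOut [FiniteDimensional ℝ V] [FiniteDimensional ℝ W]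
    {α : V → V →L[ℝ] ℝ} (hα : ContDiff ℝ ∞ α) {f : V → ℝ} (hf : ContDiff ℝ ∞ f)
    {Y : V → V} {c : V → ℝ} (hY : ContDiff ℝ ∞ Y) (hc : ContDiff ℝ ∞ c)
    (hham : ∀ᶠ x in 𝓝 0, α x (Y x) = 0 ∧
      ∀ v, extD α x (Y x) v = fderiv ℝ f x v - c x * α x v)
    {τ : W →L[ℝ] ℝ} {w₀ : W} (hτ : τ w₀ = 1) {g : W → V} (hg : ContDiff ℝ ∞ g) (hg0 : g 0 = 0)
    (hgw : ∀ w (t : ℝ), g (w + t • w₀) = g w) (hgα : ∀ᶠ w in 𝓝 0, pullForm g α w = 0)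
    (hgf : ∀ᶠ w in 𝓝 0, f (g w) = f 0) :
    ∃ i : W → V, ContDiff ℝ ∞ i ∧ i 0 = 0 ∧
      HasFDerivAt i (fderiv ℝ g 0 + τ.smulRight (Y 0)) 0 ∧
      (∀ᶠ w in 𝓝 0, pullForm i α w = 0) ∧ ∀ᶠ w in 𝓝 0, f (i w) = f 0 := by
  obtain ⟨Φ₀, hΦ₀, hΦ₀0, hΦ₀t⟩ := exists_smooth_flow hY (0 : V)
  obtain ⟨Φ, hΦ, hΦe⟩ := exists_contDiff_eventuallyEq hΦ₀
  have hzero : ∀ᶠ x in 𝓝 (0 : V), Φ (0, x) = x := by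
    have hcont : Filter.Tendsto (fun x : V => ((0 : ℝ), x)) (𝓝 0) (𝓝 (0, 0)) :=
      Continuous.tendsto (by fun_prop) _
    filter_upwards [hΦ₀0, hcont.eventually hΦe] with x hx hx'
    rw [hx', hx]
  have htime : ∀ᶠ p in 𝓝 ((0 : ℝ), (0 : V)), fderiv ℝ Φ p (1, 0) = Y (Φ p) := by
    filter_upwards [hΦ₀t, hΦe.eventuallyEq_nhds] with p hp hpe
    have h1 : HasDerivAt (fun t : ℝ => (t, p.2)) ((1 : ℝ), (0 : V)) p.1 :=
      (hasDerivAt_id _).prodMk (hasDerivAt_const _ _)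
    have h2 : HasDerivAt (fun t : ℝ => Φ (t, p.2)) (fderiv ℝ Φ p (1, 0)) p.1 :=
      HasFDerivAt.comp_hasDerivAt (l := Φ) p.1
        (hΦ.differentiable (by simp) p).hasFDerivAt h1
    have hcont : Filter.Tendsto (fun t : ℝ => (t, p.2)) (𝓝 p.1) (𝓝 p) :=
      Continuous.tendsto (f := fun t : ℝ => (t, p.2)) (by fun_prop) p.1
    have h3 : (fun t : ℝ => Φ₀ (t, p.2)) =ᶠ[𝓝 p.1] fun t => Φ (t, p.2) := by
      filter_upwards [hcont.eventually hpe] with t ht using ht.symm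
    rw [h2.unique (hp.congr_of_eventuallyEq h3.symm), hpe.self_of_nhds]
  have hspace : ∀ᶠ x in 𝓝 (0 : V), ∀ v, fderiv ℝ Φ (0, x) (0, v) = v := by
    filter_upwards [hzero.eventually_nhds] with x hx v
    have h1 : HasFDerivAt (fun x : V => Φ (0, x))
        ((fderiv ℝ Φ (0, x)).comp (ContinuousLinearMap.inr ℝ ℝ V)) x :=
      HasFDerivAt.comp (g := Φ) x (hΦ.differentiable (by simp) _).hasFDerivAt
        (hasFDerivAt_prodMk_right (0 : ℝ) x)
    have h2 := h1.unique ((hasFDerivAt_id x).congr_of_eventuallyEq hx)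
    exact congrArg (· v) h2
  let q : W → ℝ × V := fun w => (τ w, g w)
  have hq : ContDiff ℝ ∞ q := τ.contDiff.prodMk hg
  have hq0 : q 0 = (0, 0) := by simp [q, hg0]
  have hqt : Filter.Tendsto q (𝓝 0) (𝓝 (0, 0)) := by
    rw [← hq0]
    exact hq.continuous.tendsto 0
  have hgt : Filter.Tendsto g (𝓝 0) (𝓝 0) := by
    have := hg.continuous.tendsto 0
    rwa [hg0] at this
  -- Flow `g w` along `Y` for time `τ w`. As `g` is constant in the direction `w₀` and `τ w₀ = 1`,
  -- moving along `w₀` in `W` means moving along `Y` in `V`.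
  let i : W → V := fun w => Φ (q w)
  have hi : ContDiff ℝ ∞ i := hΦ.comp hq
  have hi0 : i 0 = 0 := by
    change Φ (q 0) = 0
    rw [hq0, hzero.self_of_nhds]
  have hit : Filter.Tendsto i (𝓝 0) (𝓝 0) := by
    have := hi.continuous.tendsto 0
    rwa [hi0] at this
  have hgd : ∀ w, HasFDerivAt g (fderiv ℝ g w) w := fun w =>
    (hg.differentiable (by simp) w).hasFDerivAt
  have hid : ∀ w v, fderiv ℝ i w v = fderiv ℝ Φ (q w) (τ v, fderiv ℝ g w v) := fun w v => by
    have h1 := HasFDerivAt.comp (g := Φ) w (hΦ.differentiable (by simp) (q w)).hasFDerivAt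
      (τ.hasFDerivAt.prodMk (hgd w))
    have h2 : fderiv ℝ i w = _ := h1.fderiv
    rw [h2]
    rfl
  have hgw0 : ∀ w, fderiv ℝ g w w₀ = 0 := fun w => by
    have h1 : HasDerivAt (fun t : ℝ => w + t • w₀) w₀ 0 := by
      simpa using ((hasDerivAt_id (0 : ℝ)).smul_const w₀).const_add w
    have h2 := HasFDerivAt.comp_hasDerivAt_of_eq (0 : ℝ) (hgd w) h1 (by simp)
    have h3 : HasDerivAt (g ∘ fun t : ℝ => w + t • w₀) 0 0 := by
      have : (g ∘ fun t : ℝ => w + t • w₀) = fun _ => g w := funext fun t => hgw w t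
      rw [this]
      exact hasDerivAt_const _ _
    exact h2.unique h3
  have hiw0 : ∀ᶠ w in 𝓝 0, fderiv ℝ i w w₀ = Y (i w) := by
    filter_upwards [hqt.eventually htime] with w hw
    rw [hid, hgw0, hτ, hw]
  have hisplit : ∀ᶠ w in 𝓝 0, τ w = 0 →
      i w = g w ∧ ∀ v, fderiv ℝ i w v = τ v • Y (g w) + fderiv ℝ g w v := by
    filter_upwards [hqt.eventually htime, hgt.eventually hspace, hgt.eventually hzero] with
      w h1 h2 h3 hw
    have hqw : q w = (0, g w) := Prod.ext hw rfl
    rw [hqw] at h1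
    refine ⟨by change Φ (q w) = _; rw [hqw, h3], fun v => ?_⟩
    have hsum : (τ v, fderiv ℝ g w v) = τ v • ((1 : ℝ), (0 : V)) + (0, fderiv ℝ g w v) := by
      simp
    rw [hid, hqw, hsum, map_add, map_smul, h1, h2, h3]
  -- Here the Grönwall constant is `0`, because `df(Y) = dα(Y, Y) + c α(Y) = 0`.
  have hlevel : ∀ᶠ w in 𝓝 0, f (i w) = f 0 := by
    have : ∀ᶠ w in 𝓝 (0 : W), f (i w) - f 0 = 0 := by
      refine eventually_eq_zero_of_transversal hτ (C := 0) ?_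
      filter_upwards [hiw0, hisplit, hgf, hit.eventually hham] with w h1 h2 h3 h4
      have hd := ((hf.differentiable (by simp) (i w)).hasFDerivAt.comp w
        (hi.differentiable (by simp) w).hasFDerivAt).sub_const (f 0)
      refine ⟨hd.differentiableAt, ?_, fun hw => by rw [(h2 hw).1, h3, sub_self]⟩
      have hd' : fderiv ℝ (fun w => f (i w) - f 0) w = _ := hd.fderiv
      have h5 := h4.2 (Y (i w))
      rw [extD_self, h4.1, mul_zero, sub_zero] at h5
      rw [hd', ContinuousLinearMap.comp_apply, h1, ← h5]
      simp
    filter_upwards [this] with w hw using sub_eq_zero.1 hw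
  refine ⟨i, hi, hi0, ?_, ?_, hlevel⟩
  · have h1 := (hi.differentiable (by simp) 0).hasFDerivAt
    convert! h1 using 1
    ext v
    rw [(hisplit.self_of_nhds (map_zero τ)).2, hg0, add_comm]
    rfl
  · have hβ : ContDiff ℝ ∞ (pullForm i α) := contDiff_pullForm hi hα
    have hβw : ∀ᶠ w in 𝓝 0, pullForm i α w w₀ = 0 := by
      filter_upwards [hiw0, hit.eventually hham] with w h1 h2
      rw [pullForm, ContinuousLinearMap.comp_apply, h1, h2.1]
    have hcb : ∀ᶠ w in 𝓝 0, ‖c (i w)‖ ≤ ‖c (i 0)‖ + 1 := by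
      have : Continuous fun w => ‖c (i w)‖ := (hc.continuous.comp hi.continuous).norm
      filter_upwards [this.continuousAt.eventually_lt continuousAt_const
        (lt_add_one ‖c (i 0)‖)] with w hw using hw.le
    refine eventually_eq_zero_of_transversal hτ (C := ‖c (i 0)‖ + 1) ?_
    filter_upwards [hiw0, hisplit, hgα, hit.eventually hham, hgt.eventually hham, hcb,
      hβw.eventually_nhds, hlevel.eventually_nhds] with w h1 h2 h3 h4 h5 h6 h7 h8
    have hβd : HasFDerivAt (pullForm i α) (fderiv ℝ (pullForm i α) w) w :=
      (hβ.differentiable (by simp) w).hasFDerivAt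
    refine ⟨hβd.differentiableAt, ?_, fun hw => ?_⟩
    · have hfi : ∀ v, fderiv ℝ f (i w) (fderiv ℝ i w v) = 0 := fun v => by
        have hd := (hf.differentiable (by simp) (i w)).hasFDerivAt.comp w
          (hi.differentiable (by simp) w).hasFDerivAt
        have h0 := hd.unique ((hasFDerivAt_const (f 0) w).congr_of_eventuallyEq h8)
        exact congrArg (· v) h0
      have hsym : ∀ v, fderiv ℝ (pullForm i α) w v w₀ = 0 := fun v => by
        have hd := hβd.clm_apply (hasFDerivAt_const w₀ w)
        have h0 := hd.unique ((hasFDerivAt_const (0 : ℝ) w).congr_of_eventuallyEq h7)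
        have := congrArg (· v) h0
        simpa using this
      -- For `β = i^*α`, the identity `β(w₀) = 0` leaves only `D_{w₀} β` in `dβ(w₀, ·)`. Naturality
      -- gives `dβ(w₀, v) = dα(Y, i_* v) = df(i_* v) - c β(v)`, and `df(i_* v) = 0` because `f ∘ i`
      -- is locally constant.
      have hder : fderiv ℝ (pullForm i α) w w₀ = (-c (i w)) • pullForm i α w := by
        ext v
        have h9 := extD_pullForm hi.contDiffAt (hα.differentiable (by simp) (i w)) w₀ v
        rw [extD, hsym, sub_zero, h1, h4.2, hfi] at h9
        rw [h9]
        simp [pullForm]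
      rw [hder, norm_smul, norm_neg]
      exact mul_le_mul_of_nonneg_right h6 (norm_nonneg _)
    · ext v
      have h0 : α (g w) (fderiv ℝ g w v) = 0 := congrArg (· v) h3
      rw [pullForm, ContinuousLinearMap.comp_apply, (h2 hw).1, (h2 hw).2, map_add, map_smul,
        h5.1, h0]
      simp

/-- A smooth parametrization, with prescribed derivative `κ`, of a part of a level of a function. -/
theorem exists_levelParametrization [FiniteDimensional ℝ V] [FiniteDimensional ℝ W] {f : V → ℝ}
    (hf : ContDiff ℝ ∞ f) {e : V} (he : fderiv ℝ f 0 e = 1) (κ : W →L[ℝ] V)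
    (hκ : ∀ w, fderiv ℝ f 0 (κ w) = 0) :
    ∃ j : W → V, ContDiff ℝ ∞ j ∧ j 0 = 0 ∧ HasFDerivAt j κ 0 ∧ ∀ᶠ w in 𝓝 0, f (j w) = f 0 := by
  -- Since `df_0(e) = 1`, one has `df_0(Θ v) = f v - f 0`. Thus `Θ` straightens the level of `f` to
  -- the hyperplane `ker df_0`, with identity derivative at `0`, and `j` is the local inverse of `Θ`
  -- composed with `κ`.
  let Θ : V → V := fun v => v + (f v - f 0 - fderiv ℝ f 0 v) • e
  have hΘ : ContDiff ℝ ∞ Θ := contDiff_id.add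
    (((hf.sub contDiff_const).sub (fderiv ℝ f 0).contDiff).smul contDiff_const)
  have hΘ0 : Θ 0 = 0 := by simp [Θ]
  have hΘd : HasFDerivAt Θ (ContinuousLinearEquiv.refl ℝ V : V →L[ℝ] V) 0 := by
    have h1 := (((hf.differentiable (by simp) 0).hasFDerivAt.sub_const (f 0)).sub
      (fderiv ℝ f 0).hasFDerivAt).smul_const e
    have h2 := (hasFDerivAt_id (0 : V)).add h1
    convert! h2 using 1
    ext v
    simp
  obtain ⟨E, h0, hcoe, hsymm, -⟩ := exists_smooth_localInverse hΘ 0 _ hΘd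
  have h0t : (0 : V) ∈ E.target := by
    have := E.map_source h0
    rwa [hcoe, hΘ0] at this
  have hE0 : E.symm 0 = 0 := by
    have := E.left_inv h0
    rwa [hcoe, hΘ0] at this
  have hκt : Filter.Tendsto κ (𝓝 0) (𝓝 0) := by
    have := κ.continuous.tendsto 0
    rwa [map_zero] at this
  have hev : ∀ᶠ w in 𝓝 (0 : W), κ w ∈ E.target := hκt.eventually (E.open_target.mem_nhds h0t)
  obtain ⟨j, hj, hje⟩ := exists_contDiff_eventuallyEq (f := fun w => E.symm (κ w)) (a := 0) (by
    filter_upwards [hev] with w hw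
    exact (hsymm.contDiffAt (E.open_target.mem_nhds hw)).comp w κ.contDiff.contDiffAt)
  refine ⟨j, hj, ?_, ?_, ?_⟩
  · rw [hje.self_of_nhds]
    dsimp only
    rw [map_zero, hE0]
  · have h1 : HasFDerivAt E.symm (ContinuousLinearEquiv.refl ℝ V : V →L[ℝ] V) 0 :=
      E.hasFDerivAt_symm (f' := ContinuousLinearEquiv.refl ℝ V) h0t
        (by rw [hcoe, hE0]; exact hΘd)
    have h2 := HasFDerivAt.comp (g := E.symm) (0 : W) (by rw [map_zero]; exact h1)
      κ.hasFDerivAt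
    exact h2.congr_of_eventuallyEq hje
  · filter_upwards [hev, hje] with w hw hjw
    have h1 := E.right_inv hw
    rw [hcoe] at h1
    have h2 := congrArg (fderiv ℝ f 0) h1
    simp only [Θ, map_add, map_smul, he, smul_eq_mul, mul_one, hκ] at h2
    rw [hjw]
    linarith

end IsotropicImmersions

/-! ### Contact reduction and the induction on dimension -/

section IsotropicImmersions

universe u

/-- A nonzero contact vector is paired to `1` with some contact vector. -/
theorem IsContactAt.exists_extD_eq_one {V : Type*} [NormedAddCommGroup V] [NormedSpace ℝ V]
    {α : V → V →L[ℝ] ℝ} {p : V} (h : IsContactAt α p) {Y : V} (hY : α p Y = 0) (hne : Y ≠ 0) :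
    ∃ e, α p e = 0 ∧ extD α p Y e = 1 := by
  obtain ⟨e, he, hYe⟩ : ∃ e, α p e = 0 ∧ extD α p Y e ≠ 0 := by
    by_contra! hcon
    exact hne (h.nondegenerate Y hY hcon)
  refine ⟨(extD α p Y e)⁻¹ • e, by rw [map_smul, he, smul_zero], ?_⟩
  rw [extD_smul_right, inv_mul_cancel₀ hYe]

/-- Contact reduction: a contact form induces a contact form on a section, transversal to the
Hamiltonian field `Y` of a function, of a level of this function. -/
theorem IsContactAt.reduction {V : Type*} [NormedAddCommGroup V] [NormedSpace ℝ V]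
    {α : V → V →L[ℝ] ℝ} (h : IsContactAt α 0) (hα : ContDiff ℝ ∞ α) {ℓ κ : V →L[ℝ] ℝ} {Y : V}
    {c : ℝ} (hY : α 0 Y = 0) (hYv : ∀ v, extD α 0 Y v = ℓ v - c * α 0 v) (hκ : κ Y = 1)
    {j : ↥((ℓ : V →ₗ[ℝ] ℝ).ker ⊓ (κ : V →ₗ[ℝ] ℝ).ker) → V} (hj : ContDiff ℝ ∞ j) (hj0 : j 0 = 0)
    (hjd : HasFDerivAt j (((ℓ : V →ₗ[ℝ] ℝ).ker ⊓ (κ : V →ₗ[ℝ] ℝ).ker).subtypeL) 0) :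
    IsContactAt (pullForm j α) 0 := by
  have hne : Y ≠ 0 := by
    rintro rfl
    simp at hκ
  obtain ⟨e, he, hYe⟩ := h.exists_extD_eq_one hY hne
  have hℓe : ℓ e = 1 := by rw [← hYe, hYv, he, mul_zero, sub_zero]
  have hℓY : ℓ Y = 0 := by
    have := hYv Y
    rw [extD_self, hY] at this
    linarith
  have hα' : ∀ u, pullForm j α 0 u = α 0 u := fun u => by
    rw [pullForm, hjd.fderiv, hj0]
    rfl
  have hd' : ∀ u v, extD (pullForm j α) 0 u v = extD α 0 u v := fun u v => by
    rw [extD_pullForm hj.contDiffAt (hα.differentiable (by simp) _), hjd.fderiv, hj0]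
    rfl
  -- The splitting of `V` into `ker ℓ ∩ ker κ` and the plane spanned by the contact vectors `e` and
  -- `Y`.
  have hmem : ∀ v, v - ℓ v • e - κ (v - ℓ v • e) • Y ∈
      (ℓ : V →ₗ[ℝ] ℝ).ker ⊓ (κ : V →ₗ[ℝ] ℝ).ker := fun v => by
    simp only [Submodule.mem_inf, LinearMap.mem_ker, ContinuousLinearMap.coe_coe]
    constructor <;> simp [hℓe, hℓY, hκ]
  refine ⟨fun h0 => h.ne_zero ?_, fun u hu huv => ?_⟩
  · ext v
    have h1 : pullForm j α 0 ⟨_, hmem v⟩ = 0 := by rw [h0]; rfl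
    rw [hα'] at h1
    simpa [he, hY] using h1
  · have hu' : α 0 (u : V) = 0 := by rw [← hα', hu]
    have hℓu : ℓ (u : V) = 0 := u.2.1
    have hκu : κ (u : V) = 0 := u.2.2
    have huY : extD α 0 (u : V) Y = 0 := by
      rw [extD_swap, hYv, hℓu, hu']
      ring
    have hker : ∀ v, α 0 v = 0 → extD α 0 (u : V) v = ℓ v * extD α 0 (u : V) e := by
      intro v hv
      have h1 : extD (pullForm j α) 0 u ⟨_, hmem v⟩ = 0 := huv _ (by
        rw [hα']
        simp [he, hY, hv])
      rw [hd'] at h1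
      have h2 : v = (v - ℓ v • e - κ (v - ℓ v • e) • Y) + (ℓ v • e + κ (v - ℓ v • e) • Y) := by
        abel
      calc extD α 0 (u : V) v
          = extD α 0 (u : V) ((v - ℓ v • e - κ (v - ℓ v • e) • Y) +
              (ℓ v • e + κ (v - ℓ v • e) • Y)) := by rw [← h2]
        _ = ℓ v * extD α 0 (u : V) e := by
          rw [extD_add_right, h1, extD_add_right, extD_smul_right, extD_smul_right, huY]
          ring
    -- On `ker α` the functional `dα(u, ·)` equals `dα(u, e) ℓ`, which is `dα(u, e) dα(Y, ·)`. So
    -- `u` is a multiple of `Y`, and `κ(u) = 0` with `κ(Y) = 1` forces `u = 0`.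
    have hu0 : (u : V) + (-extD α 0 (u : V) e) • Y = 0 := by
      refine h.nondegenerate _ (by simp [hu', hY]) fun v hv => ?_
      rw [extD_add_left, extD_smul_left, hker v hv, hYv, hv]
      ring
    have h3 := congrArg κ hu0
    rw [map_add, map_smul, hκu, hκ, map_zero, zero_add, smul_eq_mul, mul_one] at h3
    rw [h3, zero_smul, add_zero] at hu0
    exact Subtype.ext hu0

/-- An isotropic subspace `ι(W)` which contains the Hamiltonian vector of `f` at `0` is the tangent
space of an isotropic immersed submanifold in a level of `f`. -/
theorem exists_isotropicImmersion (n : ℕ) : ∀ (W V : Type u) [NormedAddCommGroup W]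
    [NormedSpace ℝ W] [FiniteDimensional ℝ W] [NormedAddCommGroup V] [NormedSpace ℝ V]
    [FiniteDimensional ℝ V] (_ : finrank ℝ W = n + 1) (α : V → V →L[ℝ] ℝ) (f : V → ℝ)
    (_ : ContDiff ℝ ∞ α) (_ : ContDiff ℝ ∞ f) (_ : IsContactAt α 0) (ι : W →L[ℝ] V)
    (_ : Function.Injective ι) (_ : ∀ w, α 0 (ι w) = 0)
    (_ : ∀ w w', extD α 0 (ι w) (ι w') = 0) (w₀ : W) (_ : w₀ ≠ 0) (c : ℝ)
    (_ : ∀ v, extD α 0 (ι w₀) v = fderiv ℝ f 0 v - c * α 0 v),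
    ∃ i : W → V, ContDiff ℝ ∞ i ∧ i 0 = 0 ∧ HasFDerivAt i ι 0 ∧
      (∀ᶠ w in 𝓝 0, pullForm i α w = 0) ∧ ∀ᶠ w in 𝓝 0, f (i w) = f 0 := by
  induction n using Nat.strong_induction_on with
  | _ n ih =>
    intro W V _ _ _ _ _ _ hn α f hα hf h ι hι hια hιd w₀ hw₀ c hham
    have hne : ι w₀ ≠ 0 := (map_ne_zero_iff ι hι).2 hw₀
    obtain ⟨κ, hκ⟩ := SeparatingDual.exists_eq_one (R := ℝ) hne
    obtain ⟨e, he, hYe⟩ := h.exists_extD_eq_one (hια w₀) hne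
    have hfe : fderiv ℝ f 0 e = 1 := by rw [← hYe, hham, he, mul_zero, sub_zero]
    let K : Submodule ℝ V := (fderiv ℝ f 0 : V →ₗ[ℝ] ℝ).ker ⊓ (κ : V →ₗ[ℝ] ℝ).ker
    obtain ⟨j, hj, hj0, hjd, hjf⟩ :=
      exists_levelParametrization hf hfe K.subtypeL (fun w => w.2.1)
    have h' : IsContactAt (pullForm j α) 0 := h.reduction hα (hια w₀) hham hκ hj hj0 hjd
    have hα' : ContDiff ℝ ∞ (pullForm j α) := contDiff_pullForm hj hα
    let τ : W →L[ℝ] ℝ := κ.comp ι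
    have hτ : τ w₀ = 1 := hκ
    let W' : Submodule ℝ W := (τ : W →ₗ[ℝ] ℝ).ker
    have hfι : ∀ w, fderiv ℝ f 0 (ι w) = 0 := fun w => by
      have := hham (ι w)
      rw [hιd, hια] at this
      linarith
    let ι' : W' →L[ℝ] K := (ι.comp W'.subtypeL).codRestrict K fun w => ⟨hfι _, w.2⟩
    -- Projection along `w₀`; composing with it makes `g` constant in the direction `w₀`, as the
    -- flow-out requires.
    let pr : W →L[ℝ] W' := (ContinuousLinearMap.id ℝ W - τ.smulRight w₀).codRestrict W'
      fun w => by
        change τ (w - τ w • w₀) = 0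
        rw [map_sub, map_smul, hτ, smul_eq_mul, mul_one, sub_self]
    have hW' : finrank ℝ W' + 1 = finrank ℝ W := by
      have hr : finrank ℝ (LinearMap.range (τ : W →ₗ[ℝ] ℝ)) = 1 := by
        have : LinearMap.range (τ : W →ₗ[ℝ] ℝ) = ⊤ :=
          LinearMap.range_eq_top.2 fun t => ⟨t • w₀, by simp [hτ]⟩
        rw [this, finrank_top, finrank_self]
      rw [← LinearMap.finrank_range_add_finrank_ker (τ : W →ₗ[ℝ] ℝ), hr, add_comm]
    have hα0' : ∀ u, pullForm j α 0 u = α 0 u := fun u => by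
      rw [pullForm, hjd.fderiv, hj0]
      rfl
    have hd' : ∀ u v, extD (pullForm j α) 0 u v = extD α 0 u v := fun u v => by
      rw [extD_pullForm hj.contDiffAt (hα.differentiable (by simp) _), hjd.fderiv, hj0]
      rfl
    obtain ⟨i', hi', hi'0, hi'd, hi'α⟩ : ∃ i' : W' → K, ContDiff ℝ ∞ i' ∧ i' 0 = 0 ∧
        HasFDerivAt i' ι' 0 ∧ ∀ᶠ w in 𝓝 0, pullForm i' (pullForm j α) w = 0 := by
      rcases n with _ | n
      · have : Subsingleton W' := finrank_zero_iff.1 (by omega : finrank ℝ W' = 0)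
        refine ⟨fun _ => 0, contDiff_const, rfl, ?_, ?_⟩
        · have : ι' = 0 := by
            ext w
            rw [Subsingleton.elim w 0, map_zero]
            rfl
          rw [this]
          exact hasFDerivAt_const _ _
        · filter_upwards with w
          ext v
          rw [Subsingleton.elim v 0, map_zero, map_zero]
      · have : Nontrivial W' := finrank_pos_iff.1 (by omega : 0 < finrank ℝ W')
        obtain ⟨w₁, hw₁⟩ := exists_ne (0 : W')
        -- The reduced problem carries no function of its own. Any nonzero `w₁` serves, with the
        -- linear function `dα'(ι' w₁, ·)`, where `α'` is the reduced form: its Hamiltonian vector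
        -- at `0` is `ι' w₁`, with `c = 0`. The resulting level condition is discarded.
        let f' : K →L[ℝ] ℝ := fderiv ℝ (pullForm j α) 0 (ι' w₁) -
          (fderiv ℝ (pullForm j α) 0).flip (ι' w₁)
        obtain ⟨i', h1, h2, h3, h4, -⟩ := ih n (by omega) W' K (by omega) (pullForm j α) f' hα' f'.contDiff h' ι'
          (fun w w' hw => Subtype.ext (hι (congrArg Subtype.val hw)))
          (fun w => by rw [hα0']; exact hια _) (fun w w' => by rw [hd']; exact hιd _ _) w₁ hw₁ 0
          (fun v => by
            rw [f'.fderiv, zero_mul, sub_zero]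
            rfl)
        exact ⟨i', h1, h2, h3, h4⟩
    let g : W → V := fun w => j (i' (pr w))
    have hg : ContDiff ℝ ∞ g := hj.comp (hi'.comp pr.contDiff)
    have hg0 : g 0 = 0 := by
      change j (i' (pr 0)) = 0
      rw [map_zero, hi'0, hj0]
    have hprt : Filter.Tendsto pr (𝓝 0) (𝓝 0) := by
      have := pr.continuous.tendsto 0
      rwa [map_zero] at this
    have hipr : Filter.Tendsto (fun w => i' (pr w)) (𝓝 0) (𝓝 0) := by
      have := (hi'.continuous.tendsto 0).comp hprt
      rwa [hi'0] at this
    have hpr0 : pr w₀ = 0 := Subtype.ext (by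
      change w₀ - τ w₀ • w₀ = 0
      rw [hτ, one_smul, sub_self])
    have hgd : ∀ w, HasFDerivAt g ((fderiv ℝ j (i' (pr w))).comp
        ((fderiv ℝ i' (pr w)).comp pr)) w := fun w =>
      (hj.differentiable (by simp) _).hasFDerivAt.comp w
        ((hi'.differentiable (by simp) _).hasFDerivAt.comp w pr.hasFDerivAt)
    obtain ⟨Y, b, hY, hb, hYham⟩ := h.exists_hamiltonianField hα hf
    have hY0 : Y 0 = ι w₀ := h.hamiltonian_unique (fderiv ℝ f 0) hYham.self_of_nhds.1
      hYham.self_of_nhds.2 (hια w₀) hham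
    obtain ⟨i, hi, hi0, hid, hiα, hif⟩ := exists_flowOut hα hf hY hb hYham hτ hg hg0
      (fun w t => by
        change j (i' (pr (w + t • w₀))) = _
        rw [map_add, map_smul, hpr0, smul_zero, add_zero])
      (by
        filter_upwards [hprt.eventually hi'α] with w hw
        ext v
        have := congrArg (· (pr v)) hw
        rw [pullForm, (hgd w).fderiv]
        exact this)
      (hipr.eventually hjf)
    refine ⟨i, hi, hi0, ?_, hiα, hif⟩
    convert! hid using 1
    ext v
    rw [(hgd 0).fderiv, map_zero, hi'0, hjd.fderiv, hi'd.fderiv, hY0]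
    change ι v = ι (v - τ v • w₀) + τ v • ι w₀
    rw [map_sub, map_smul, sub_add_cancel]

end IsotropicImmersions

/-! ### Contact forms in arbitrary charts -/

section Charts

variable {n : ℕ} {M : Type*} [TopologicalSpace M] [ChartedSpace (Model n) M]

/-- The differential of a chart, with values in the model space. -/
def chartDeriv (e : OpenPartialHomeomorph M (Model n)) (x : M) : Model n →L[ℝ] Model n :=
  mfderiv (model n) (model n) e x

/-- The differential of the inverse of a chart. -/
def chartSymmDeriv (e : OpenPartialHomeomorph M (Model n)) (y : Model n) :
    Model n →L[ℝ] Model n :=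
  mfderiv (model n) (model n) e.symm y

/-- A `1`-form, as a function with values in the dual of the model space. -/
def covector (η : ∀ x : M, TangentSpace (model n) x →L[ℝ] ℝ) (x : M) : Model n →L[ℝ] ℝ := η x

/-- The coordinate expression of a `1`-form in a chart. -/
def chartForm (η : ∀ x : M, TangentSpace (model n) x →L[ℝ] ℝ)
    (e : OpenPartialHomeomorph M (Model n)) (y : Model n) : Model n →L[ℝ] ℝ :=
  (covector η (e.symm y)).comp (chartSymmDeriv e y)

theorem mdifferentiable_of_mem_maximalAtlas {e : OpenPartialHomeomorph M (Model n)}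
    (he : e ∈ IsManifold.maximalAtlas (model n) ∞ M) : e.MDifferentiable (model n) (model n) :=
  ⟨(contMDiffOn_of_mem_maximalAtlas he).mdifferentiableOn (by simp),
    (contMDiffOn_symm_of_mem_maximalAtlas he).mdifferentiableOn (by simp)⟩

variable {e e' : OpenPartialHomeomorph M (Model n)}
  (he : e ∈ IsManifold.maximalAtlas (model n) ∞ M)
  (he' : e' ∈ IsManifold.maximalAtlas (model n) ∞ M)

include he in
theorem chartSymmDeriv_chartDeriv {x : M} (hx : x ∈ e.source) (v : Model n) :
    chartSymmDeriv e (e x) (chartDeriv e x v) = v :=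
  congrArg (fun A : Model n →L[ℝ] Model n => A v)
    ((mdifferentiable_of_mem_maximalAtlas he).symm_comp_deriv hx)

include he in
theorem chartDeriv_chartSymmDeriv {y : Model n} (hy : y ∈ e.target) (v : Model n) :
    chartDeriv e (e.symm y) (chartSymmDeriv e y v) = v :=
  congrArg (fun A : Model n →L[ℝ] Model n => A v)
    ((mdifferentiable_of_mem_maximalAtlas he).comp_symm_deriv hy)

include he he' in
theorem contDiffAt_transition {y : Model n} (hy : y ∈ e'.target) (hy' : e'.symm y ∈ e.source) :
    ContDiffAt ℝ ∞ (e ∘ e'.symm) y :=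
  contMDiffAt_iff_contDiffAt.1 ((contMDiffAt_of_mem_maximalAtlas he hy').comp y
    (contMDiffAt_symm_of_mem_maximalAtlas he' hy))

include he he' in
theorem fderiv_transition {y : Model n} (hy : y ∈ e'.target) (hy' : e'.symm y ∈ e.source) :
    fderiv ℝ (e ∘ e'.symm) y = (chartDeriv e (e'.symm y)).comp (chartSymmDeriv e' y) := by
  have h := mfderiv_comp y
    ((mdifferentiable_of_mem_maximalAtlas he).mdifferentiableAt hy')
    ((mdifferentiable_of_mem_maximalAtlas he').mdifferentiableAt_symm hy)
  rw [mfderiv_eq_fderiv] at h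
  exact h

include he he' in
theorem chartForm_eq_pullForm (η : ∀ x : M, TangentSpace (model n) x →L[ℝ] ℝ) {y : Model n}
    (hy : y ∈ e'.target) (hy' : e'.symm y ∈ e.source) :
    chartForm η e' y = pullForm (e ∘ e'.symm) (chartForm η e) y := by
  ext v
  simp only [chartForm, pullForm, ContinuousLinearMap.comp_apply, Function.comp_apply,
    fderiv_transition he he' hy hy', e.left_inv hy', chartSymmDeriv_chartDeriv he hy']

include he he' in
theorem chartForm_eventuallyEq_pullForm (η : ∀ x : M, TangentSpace (model n) x →L[ℝ] ℝ)
    {y : Model n} (hy : y ∈ e'.target) (hy' : e'.symm y ∈ e.source) :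
    chartForm η e' =ᶠ[𝓝 y] pullForm (e ∘ e'.symm) (chartForm η e) := by
  filter_upwards [e'.open_target.mem_nhds hy,
    (e'.continuousAt_symm hy).preimage_mem_nhds (e.open_source.mem_nhds hy')] with z hz hz'
  exact chartForm_eq_pullForm he he' η hz hz'

variable [IsManifold (model n) ∞ M] (θ : ContactForm n M)

/-- Smoothness of a section of the cotangent bundle means smoothness of its trivialized expression.
The trivialization of the tangent bundle at `m` is inverted by the differential of the inverse
chart, so that expression is the coordinate form. -/
theorem contDiffAt_coordForm (m : M) :
    ContDiffAt ℝ ∞ (chartForm θ.form (chartAt (Model n) m)) (chartAt (Model n) m m) := by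
  have h := ((contMDiffAt_hom_bundle _).1 (θ.smooth m)).2
  have he := IsManifold.chart_mem_maximalAtlas (I := model n) (n := ∞) m
  have hm := mem_chart_source (Model n) m
  have h1 := h.comp_of_eq (contMDiffAt_symm_of_mem_maximalAtlas he
    ((chartAt (Model n) m).map_source hm)) ((chartAt (Model n) m).left_inv hm)
  refine (contMDiffAt_iff_contDiffAt.1 h1).congr_of_eventuallyEq ?_
  filter_upwards [(chartAt (Model n) m).open_target.mem_nhds
    ((chartAt (Model n) m).map_source hm)] with y hy
  have hx := (chartAt (Model n) m).map_target hy
  have : IsManifold (model n) 1 M := IsManifold.of_le (n := ∞) (by simp)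
  have hs : (trivializationAt (Model n) (TangentSpace (model n)) m).symmL ℝ
      ((chartAt (Model n) m).symm y) = chartSymmDeriv (chartAt (Model n) m) y := by
    refine (TangentBundle.symmL_trivializationAt (I := model n) hx).trans ?_
    have hr : range (model n) = univ := ModelWithCorners.range_eq_univ _
    have hy' : extChartAt (model n) m ((chartAt (Model n) m).symm y) = y :=
      (chartAt (Model n) m).right_inv hy
    rw [hr, mfderivWithin_univ, hy']
    rfl
  ext v
  change _ = (Bundle.Trivialization.continuousLinearMapAt ℝ
    (trivializationAt ℝ (Bundle.Trivial M ℝ) m) ((chartAt (Model n) m).symm y))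
    (covector θ.form ((chartAt (Model n) m).symm y)
      ((trivializationAt (Model n) (TangentSpace (model n)) m).symmL ℝ
        ((chartAt (Model n) m).symm y) v))
  rw [hs]
  simp only [chartForm, ContinuousLinearMap.comp_apply]
  simp
  rfl

include he in
-- Near `y` the form is the pullback, under the transition map, of its expression in the preferred
-- chart at `e.symm y`.
theorem contDiffAt_chartForm {y : Model n} (hy : y ∈ e.target) :
    ContDiffAt ℝ ∞ (chartForm θ.form e) y := by
  let q := e.symm y
  have hq := IsManifold.chart_mem_maximalAtlas (I := model n) (n := ∞) q
  have hqs := mem_chart_source (Model n) q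
  refine ContDiffAt.congr_of_eventuallyEq ?_
    (chartForm_eventuallyEq_pullForm hq he θ.form hy hqs)
  exact contDiffAt_pullForm (contDiffAt_transition hq he hy hqs) (contDiffAt_coordForm θ q)

include he in
/-- The exterior derivative may be computed in any chart. -/
theorem dForm_eq_extD {q : M} (hq : q ∈ e.source) (u v : Model n) :
    dForm θ.form q u v =
      extD (chartForm θ.form e) (e q) (chartDeriv e q u) (chartDeriv e q v) := by
  have hc := IsManifold.chart_mem_maximalAtlas (I := model n) (n := ∞) q
  have hqs := mem_chart_source (Model n) q
  have ht := (chartAt (Model n) q).map_source hqs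
  have hct := (chartAt (Model n) q).left_inv hqs
  have hcs : (chartAt (Model n) q).symm (chartAt (Model n) q q) ∈ e.source := by rwa [hct]
  change extD (chartForm θ.form (chartAt (Model n) q)) (chartAt (Model n) q q)
    (chartDeriv (chartAt (Model n) q) q u) (chartDeriv (chartAt (Model n) q) q v) = _
  rw [extD_congr (chartForm_eventuallyEq_pullForm he hc θ.form ht hcs),
    extD_pullForm (contDiffAt_transition he hc ht hcs)
      (((contDiffAt_chartForm he θ (e.map_source hcs)).differentiableAt (by simp))),
    fderiv_transition he hc ht hcs]
  simp only [ContinuousLinearMap.comp_apply, Function.comp_apply,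
    chartSymmDeriv_chartDeriv hc hqs, hct]

end Charts

/-! ### Contact data in a centered chart and integral curves of the Hamiltonian field -/

section Charts

variable {n : ℕ} {M : Type*} [TopologicalSpace M] [ChartedSpace (Model n) M]
  {e : OpenPartialHomeomorph M (Model n)}

theorem fderiv_comp_chart_symm (he : e ∈ IsManifold.maximalAtlas (model n) ∞ M) {g : M → ℝ}
    {y : Model n} (hy : y ∈ e.target) (hg : MDifferentiableAt (model n) 𝓘(ℝ, ℝ) g (e.symm y))
    (v : Model n) :
    fderiv ℝ (g ∘ e.symm) y v = differential g (e.symm y) (chartSymmDeriv e y v) := by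
  have h := mfderiv_comp y hg ((mdifferentiable_of_mem_maximalAtlas he).mdifferentiableAt_symm hy)
  rw [mfderiv_eq_fderiv] at h
  exact congrArg (fun A : Model n →L[ℝ] ℝ => A v) h

variable [IsManifold (model n) ∞ M] (θ : ContactForm n M)

theorem reeb_spec (m : M) : θ.form m (θ.reeb m) = 1 ∧ ∀ v, dForm θ.form m (θ.reeb m) v = 0 :=
  Classical.choose_spec (exists_reeb θ m)

theorem hamiltonian_spec (f : M → ℝ) (m : M) : θ.form m (θ.hamiltonian f m) = 0 ∧
    ∀ v, dForm θ.form m (θ.hamiltonian f m) v =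
      differential f m v - differential f m (θ.reeb m) * θ.form m v :=
  Classical.choose_spec (exists_hamiltonian θ f m)

/-- The Hamiltonian vector is determined by its contact differential modulo the contact form. -/
theorem eq_hamiltonian {f : M → ℝ} {m : M} {Y : TangentSpace (model n) m} {c : ℝ}
    (h1 : θ.form m Y = 0)
    (h2 : ∀ v, dForm θ.form m Y v = differential f m v - c * θ.form m v) :
    Y = θ.hamiltonian f m := by
  refine hamiltonian_unique θ f m Y h1 fun v => ?_
  -- Evaluation on the Reeb vector forces `c = df(Z)`.
  have h3 := h2 (θ.reeb m)
  rw [dForm_swap, (reeb_spec θ m).2, (reeb_spec θ m).1] at h3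
  rw [h2, show c = differential f m (θ.reeb m) by linarith]

/-- `α` and `g` are smooth extensions of the expressions of `θ` and `f` in the chart `e`, with
the point `m` moved to the origin. -/
structure IsCenteredExpression (e : OpenPartialHomeomorph M (Model n)) (f : M → ℝ) (p : Model n)
    (α : Model n → Model n →L[ℝ] ℝ) (g : Model n → ℝ) : Prop where
  contDiff_form : ContDiff ℝ ∞ α
  contDiff_fun : ContDiff ℝ ∞ g
  eventually_target : ∀ᶠ x in 𝓝 0, p + x ∈ e.target
  form_eq : ∀ᶠ x in 𝓝 0, ∀ v,
    α x v = covector θ.form (e.symm (p + x)) (chartSymmDeriv e (p + x) v)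
  extD_eq : ∀ᶠ x in 𝓝 0, ∀ u v, extD α x u v = dForm θ.form (e.symm (p + x))
    (chartSymmDeriv e (p + x) u) (chartSymmDeriv e (p + x) v)
  fun_eq : ∀ᶠ x in 𝓝 0, g x = f (e.symm (p + x))
  fderiv_eq : ∀ᶠ x in 𝓝 0, ∀ v, fderiv ℝ g x v =
    differential f (e.symm (p + x)) (chartSymmDeriv e (p + x) v)

/-- The normed-space results take globally smooth data, whereas chart expressions are smooth only on
the target. Cutting off by a bump function changes nothing near the origin. -/
theorem exists_isCenteredExpression (he : e ∈ IsManifold.maximalAtlas (model n) ∞ M)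
    {f : M → ℝ} (hf : ContMDiff (model n) 𝓘(ℝ, ℝ) ∞ f) {p : Model n} (hp : p ∈ e.target) :
    ∃ α g, IsCenteredExpression θ e f p α g := by
  have hadd : ContDiff ℝ ∞ fun x : Model n => p + x := contDiff_const.add contDiff_id
  have ht : Filter.Tendsto (fun x : Model n => p + x) (𝓝 0) (𝓝 p) := by
    have := hadd.continuous.tendsto 0
    rwa [add_zero] at this
  have htar : ∀ᶠ x in 𝓝 (0 : Model n), p + x ∈ e.target :=
    ht.eventually (e.open_target.mem_nhds hp)
  obtain ⟨α, hα, hαe⟩ := exists_contDiff_eventuallyEq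
    (f := fun x => chartForm θ.form e (p + x)) (a := 0) (by
      filter_upwards [htar] with x hx
      exact (contDiffAt_chartForm he θ hx).comp x hadd.contDiffAt)
  obtain ⟨g, hg, hge⟩ := exists_contDiff_eventuallyEq
    (f := fun x => (f ∘ e.symm) (p + x)) (a := 0) (by
      filter_upwards [htar] with x hx
      exact (contMDiffAt_iff_contDiffAt.1
        (hf.contMDiffAt.comp (p + x) (contMDiffAt_symm_of_mem_maximalAtlas he hx))).comp x
          hadd.contDiffAt)
  refine ⟨α, g, hα, hg, htar, ?_, ?_, hge, ?_⟩
  · filter_upwards [hαe] with x hx v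
    rw [hx]
    rfl
  · filter_upwards [hαe.eventuallyEq_nhds, htar] with x hx hxt u v
    rw [dForm_eq_extD he θ (e.map_target hxt), chartDeriv_chartSymmDeriv he hxt,
      chartDeriv_chartSymmDeriv he hxt, e.right_inv hxt, extD_congr hx]
    simp only [extD, fderiv_comp_add_left]
  · filter_upwards [hge.eventuallyEq_nhds, htar] with x hx hxt v
    rw [hx.fderiv_eq, fderiv_comp_add_left,
      fderiv_comp_chart_symm he hxt (hf.contMDiffAt.mdifferentiableAt (by simp))]

variable {θ}

theorem IsCenteredExpression.isContactAt (he : e ∈ IsManifold.maximalAtlas (model n) ∞ M)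
    {f : M → ℝ} {p : Model n} {α : Model n → Model n →L[ℝ] ℝ} {g : Model n → ℝ}
    (h : IsCenteredExpression θ e f p α g) : IsContactAt α 0 := by
  have ht := h.eventually_target.self_of_nhds
  have hα := h.form_eq.self_of_nhds
  have hd := h.extD_eq.self_of_nhds
  have hsurj : ∀ v, chartSymmDeriv e (p + 0) (chartDeriv e (e.symm (p + 0)) v) = v := fun v => by
    have := chartSymmDeriv_chartDeriv he (e.map_target ht) v
    rwa [e.right_inv ht] at this
  refine ⟨fun h0 => θ.ne_zero (e.symm (p + 0)) ?_, fun u hu huv => ?_⟩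
  · refine ContinuousLinearMap.ext fun v => ?_
    change covector θ.form (e.symm (p + 0)) v = 0
    rw [← hsurj v, ← hα, h0]
    rfl
  · have h0 : chartSymmDeriv e (p + 0) u = 0 := by
      refine θ.nondegenerate (e.symm (p + 0)) (chartSymmDeriv e (p + 0) u) ?_ fun v hv => ?_
      · exact (hα u).symm.trans hu
      · obtain ⟨w, rfl⟩ : ∃ w : Model n, chartSymmDeriv e (p + 0) w = v := ⟨_, hsurj v⟩
        exact (hd u w).symm.trans (huv w ((hα w).trans hv))
    rw [← chartDeriv_chartSymmDeriv he ht u, h0, map_zero]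

theorem IsCenteredExpression.chartSymmDeriv_eq_hamiltonian
    (he : e ∈ IsManifold.maximalAtlas (model n) ∞ M)
    {f : M → ℝ} {p : Model n} {α : Model n → Model n →L[ℝ] ℝ} {g : Model n → ℝ}
    (h : IsCenteredExpression θ e f p α g) : ∀ᶠ x in 𝓝 0, ∀ (Y : Model n) (c : ℝ), α x Y = 0 →
      (∀ v, extD α x Y v = fderiv ℝ g x v - c * α x v) →
      chartSymmDeriv e (p + x) Y = θ.hamiltonian f (e.symm (p + x)) := by
  filter_upwards [h.eventually_target, h.form_eq, h.extD_eq, h.fderiv_eq] with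
    x ht hα hd hg Y c hY hYv
  have hsurj : ∀ v, chartSymmDeriv e (p + x) (chartDeriv e (e.symm (p + x)) v) = v := fun v => by
    have := chartSymmDeriv_chartDeriv he (e.map_target ht) v
    rwa [e.right_inv ht] at this
  refine eq_hamiltonian θ (c := c) ?_ fun v => ?_
  · exact (hα Y).symm.trans hY
  · obtain ⟨w, rfl⟩ : ∃ w : Model n, chartSymmDeriv e (p + x) w = v := ⟨_, hsurj v⟩
    have h1 := hYv w
    rw [hd, hg, hα] at h1
    exact h1

/-- The integral curves of the Hamiltonian field through a given point exist. -/
theorem exists_integralCurve_hamiltonian {f : M → ℝ} (hf : ContMDiff (model n) 𝓘(ℝ, ℝ) ∞ f)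
    (m : M) : ∃ (γ : ℝ → M) (ε : ℝ), 0 < ε ∧ γ 0 = m ∧
      IsMIntegralCurveOn γ (θ.hamiltonian f) (Ioo (-ε) ε) := by
  let e := chartAt (Model n) m
  have he : e ∈ IsManifold.maximalAtlas (model n) ∞ M := IsManifold.chart_mem_maximalAtlas m
  have hm : m ∈ e.source := mem_chart_source _ m
  obtain ⟨α, g, h⟩ := exists_isCenteredExpression θ he hf (e.map_source hm)
  obtain ⟨Y, c, hY, -, hYham⟩ := (h.isContactAt he).exists_hamiltonianField
    h.contDiff_form h.contDiff_fun
  -- Picard–Lindelöf for the globally smooth field `Y`. The time interval is then shortened so that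
  -- the curve stays where `Y` represents the Hamiltonian field.
  obtain ⟨a, ha0, ε, hε, ha⟩ := (hY.contDiffAt (x := 0)).of_le
    (by simp : (1 : WithTop ℕ∞) ≤ ∞) |>.exists_forall_mem_closedBall_exists_eq_forall_mem_Ioo_hasDerivAt₀ 0
  have hat : Filter.Tendsto a (𝓝 0) (𝓝 0) := by
    have := (ha 0 ⟨by linarith, by linarith⟩).continuousAt.tendsto
    rwa [ha0] at this
  have hev := hat.eventually (h.eventually_target.and
    (hYham.and (h.chartSymmDeriv_eq_hamiltonian he)))
  obtain ⟨δ, hδ, hball⟩ := Metric.eventually_nhds_iff.1 hev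
  refine ⟨fun t => e.symm (e m + a t), min ε δ, lt_min hε hδ, ?_, fun t ht => ?_⟩
  · simp only [ha0, add_zero]
    exact e.left_inv hm
  · have ht' : dist t 0 < δ := by
      rw [Real.dist_eq, sub_zero, abs_lt]
      exact ⟨by linarith [ht.1, min_le_right ε δ], by linarith [ht.2, min_le_right ε δ]⟩
    obtain ⟨h1, ⟨h2, h3⟩, h4⟩ := hball ht'
    have hd := (ha t ⟨by linarith [ht.1, min_le_left ε δ],
      by linarith [ht.2, min_le_left ε δ]⟩).const_add (e m)
    have hmd := ((mdifferentiable_of_mem_maximalAtlas he).mdifferentiableAt_symm h1).hasMFDerivAt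
    have hcomp := hmd.comp t hd.hasFDerivAt.hasMFDerivAt
    refine (HasMFDerivAt.congr_mfderiv hcomp (ContinuousLinearMap.ext (M₁ := ℝ) (M₂ := Model n)
      fun s => ?_)).hasMFDerivWithinAt
    have h5 := h4 (Y (a t)) _ h2 h3
    exact ((chartSymmDeriv e (e m + a t)).map_smul s (Y (a t))).trans
      (congrArg (fun z : Model n => s • z) h5)

end Charts

/-! ### Tangent spaces of submanifolds in adapted charts -/

section TangentSpaces

variable {n : ℕ} {M : Type*} [TopologicalSpace M] [ChartedSpace (Model n) M]
  {φ : OpenPartialHomeomorph M (Model n)}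

/-- A short line in `V` through `φ m` corresponds to a curve in `S`, along which every function
vanishing on `S` has zero derivative. -/
theorem chartSymmDeriv_mem_tangentSpaceOf (hφ : φ ∈ IsManifold.maximalAtlas (model n) ∞ M)
    {S : Set M} {m : M} (hm : m ∈ φ.source) (hmS : m ∈ S) {V : Submodule ℝ (Model n)}
    (hV : φ '' (S ∩ φ.source) = φ.target ∩ (V : Set (Model n))) {w : Model n} (hw : w ∈ V) :
    chartSymmDeriv φ (φ m) w ∈ tangentSpaceOf (n := n) S m := by
  intro g hg hgS
  have ht := φ.map_source hm
  have hmV : φ m ∈ V := (hV.subset ⟨m, ⟨hmS, hm⟩, rfl⟩ : φ m ∈ φ.target ∩ (V : Set (Model n))).2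
  have hgd : MDifferentiableAt (model n) 𝓘(ℝ, ℝ) g (φ.symm (φ m)) := by
    rw [φ.left_inv hm]
    exact hg.mdifferentiableAt (by simp)
  let ℓ : ℝ → Model n := fun t => φ m + t • w
  have hℓ : HasDerivAt ℓ w 0 := by
    simpa [ℓ] using ((hasDerivAt_id (0 : ℝ)).smul_const w).const_add (φ m)
  have hℓ0 : ℓ 0 = φ m := by simp [ℓ]
  have hℓt : Filter.Tendsto ℓ (𝓝 0) (𝓝 (φ m)) := by
    rw [← hℓ0]
    exact hℓ.continuousAt.tendsto
  have hc : Filter.Tendsto (fun t => φ.symm (ℓ t)) (𝓝 0) (𝓝[S] m) := by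
    refine tendsto_nhdsWithin_iff.2 ⟨?_, ?_⟩
    · have := (φ.continuousAt_symm ht).tendsto.comp hℓt
      rwa [φ.left_inv hm] at this
    · filter_upwards [hℓt.eventually (φ.open_target.mem_nhds ht)] with t htt
      have : ℓ t ∈ φ '' (S ∩ φ.source) :=
        hV.superset ⟨htt, V.add_mem hmV (V.smul_mem t hw)⟩
      obtain ⟨x, hx, hxt⟩ := this
      rw [← hxt, φ.left_inv hx.2]
      exact hx.1
  have hdiff : DifferentiableAt ℝ (g ∘ φ.symm) (φ m) :=
    mdifferentiableAt_iff_differentiableAt.1 (hgd.comp (φ m)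
      ((mdifferentiable_of_mem_maximalAtlas hφ).mdifferentiableAt_symm ht))
  have h1 : HasDerivAt ((g ∘ φ.symm) ∘ ℓ) (fderiv ℝ (g ∘ φ.symm) (φ m) w) 0 :=
    HasFDerivAt.comp_hasDerivAt_of_eq 0 hdiff.hasFDerivAt hℓ hℓ0.symm
  have h2 : HasDerivAt ((g ∘ φ.symm) ∘ ℓ) 0 0 :=
    (hasDerivAt_const (0 : ℝ) (0 : ℝ)).congr_of_eventuallyEq (hc.eventually hgS)
  have h3 := h1.unique h2
  rw [fderiv_comp_chart_symm hφ ht hgd] at h3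
  let D : M → Model n →L[ℝ] ℝ := fun x => differential g x
  change D (φ.symm (φ m)) (chartSymmDeriv φ (φ m) w) = 0 at h3
  rwa [φ.left_inv hm] at h3

/-- The functions `⟨w, φ⟩` with `w` orthogonal to `V` vanish on `S` near `m`, and they suffice to
test membership in `V = V^⊥⊥`. -/
theorem chartDeriv_mem_of_mem_tangentSpaceOf (hφ : φ ∈ IsManifold.maximalAtlas (model n) ∞ M)
    {S : Set M} {m : M} (hm : m ∈ φ.source) {V : Submodule ℝ (Model n)}
    (hV : φ '' (S ∩ φ.source) = φ.target ∩ (V : Set (Model n))) {u : TangentSpace (model n) m}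
    (hu : u ∈ tangentSpaceOf (n := n) S m) : chartDeriv φ m u ∈ V := by
  rw [← V.orthogonal_orthogonal, Submodule.mem_orthogonal]
  intro w hw
  let g : M → ℝ := (innerSL ℝ w) ∘ φ
  have hφm := contMDiffAt_of_mem_maximalAtlas hφ hm
  have hg : ContMDiffAt (model n) 𝓘(ℝ, ℝ) ∞ g m :=
    (innerSL ℝ w).contDiff.contMDiff.contMDiffAt.comp m hφm
  have h1 := hu g hg (by
    filter_upwards [self_mem_nhdsWithin,
      mem_nhdsWithin_of_mem_nhds (φ.open_source.mem_nhds hm)] with x hx hx'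
    have : φ x ∈ φ.target ∩ (V : Set (Model n)) := hV.subset ⟨x, ⟨hx, hx'⟩, rfl⟩
    exact (Submodule.mem_orthogonal' _ _).1 hw _ this.2)
  have h2 := mfderiv_comp m
    ((innerSL ℝ w).contDiff.contMDiff.contMDiffAt.mdifferentiableAt (n := ∞) (by simp) (x := φ m))
    (hφm.mdifferentiableAt (by simp))
  rw [mfderiv_eq_fderiv, ContinuousLinearMap.fderiv] at h2
  exact (congrArg (fun A : Model n →L[ℝ] ℝ => A u) h2).symm.trans h1

/-- Only this inequality is needed: it activates the condition `L ⊆ U ∩ 𝒞_m` in the prolongation of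
a tangent space. -/
theorem le_finrank_tangentSpaceOf {k : ℕ} {S : Set M} (hS : IsSubmanifold (n := n) k S) {m : M}
    (hm : m ∈ S) : k ≤ finrank ℝ (tangentSpaceOf (n := n) S m) := by
  obtain ⟨φ, hφ, hmφ, V, hVk, hV⟩ := hS m hm
  have hinj : Function.Injective (chartSymmDeriv φ (φ m)) := fun w w' h => by
    have ht := φ.map_source hmφ
    rw [← chartDeriv_chartSymmDeriv hφ ht w, h, chartDeriv_chartSymmDeriv hφ ht]
  rw [← hVk]
  let A : V →ₗ[ℝ] tangentSpaceOf (n := n) S m :=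
    LinearMap.codRestrict (tangentSpaceOf (n := n) S m)
      ((chartSymmDeriv φ (φ m) : Model n →ₗ[ℝ] Model n).comp V.subtype)
      fun w => chartSymmDeriv_mem_tangentSpaceOf hφ hmφ hm hV w.2
  refine LinearMap.finrank_le_finrank_of_injective (f := A) fun w w' h => ?_
  exact Subtype.ext (hinj (congrArg Subtype.val h))

end TangentSpaces

/-! ### Linear algebra of Lagrangian planes -/

section Planes

variable {n : ℕ} {M : Type*} [TopologicalSpace M] [ChartedSpace (Model n) M]
  [IsManifold (model n) ∞ M] {θ : ContactForm n M}

theorem finrank_contactPlane (m : M) : finrank ℝ (θ.plane m) = 2 * n := by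
  have h1 := Module.Dual.finrank_ker_add_one_of_ne_zero (K := ℝ)
    (f := (θ.form m : TangentSpace (model n) m →ₗ[ℝ] ℝ)) (fun h => θ.ne_zero m (by
      refine ContinuousLinearMap.ext fun v => ?_
      exact LinearMap.congr_fun h v))
  have h2 : finrank ℝ (TangentSpace (model n) m) = 2 * n + 1 :=
    (finrank_euclideanSpace_fin : finrank ℝ (Model n) = 2 * n + 1)
  rw [h2] at h1
  exact Nat.add_right_cancel h1

/-- Lagrangian planes are maximal isotropic. -/
theorem IsLagrangianPlane.mem_of_forall {m : M} {L : Submodule ℝ (TangentSpace (model n) m)}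
    (hL : IsLagrangianPlane θ m L) {Y : TangentSpace (model n) m} (hY : θ.form m Y = 0)
    (hYL : ∀ v ∈ L, dForm θ.form m Y v = 0) : Y ∈ L := by
  let B : LinearMap.BilinForm ℝ (θ.plane m) :=
    (dForm θ.form m).domRestrict₁₂ (θ.plane m) (θ.plane m)
  have hB : ∀ u v : θ.plane m, B u v = dForm θ.form m u v := fun _ _ => rfl
  have hrefl : B.IsRefl := fun u v h => by
    rw [hB] at h ⊢
    rw [dForm_swap, h, neg_zero]
  have hnd : B.Nondegenerate := by
    refine hrefl.nondegenerate_iff_separatingLeft.2 fun u hu => Subtype.ext (θ.nondegenerate m u u.2 fun v hv => hu ⟨v, hv⟩)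
  let L' : Submodule ℝ (θ.plane m) := L.comap (θ.plane m).subtype
  have hL' : finrank ℝ L' = n :=
    (Submodule.comapSubtypeEquivOfLe hL.le_plane).finrank_eq.trans hL.finrank_eq
  -- The orthogonal of `L` in `𝒞_m` has dimension `2n - n = n` and contains `L`, so it equals `L`.
  have horth : finrank ℝ (B.orthogonal L') = n := by
    rw [LinearMap.BilinForm.finrank_orthogonal hnd, hL', finrank_contactPlane]
    omega
  have hle : L' ≤ B.orthogonal L' := fun u hu v hv => hL.isotropic _ hv _ hu
  have heq := Submodule.eq_of_le_of_finrank_eq hle (by rw [hL', horth])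
  have : (⟨Y, hY⟩ : θ.plane m) ∈ B.orthogonal L' := fun v hv => by
    change dForm θ.form m v Y = 0
    rw [dForm_swap, hYL v.1 hv, neg_zero]
  rw [← heq] at this
  exact this

end Planes

/-! ### Lagrangian submanifolds with prescribed tangent plane -/

section Existence

variable {n : ℕ} {M : Type*} [TopologicalSpace M] [ChartedSpace (Model n) M]

theorem chartSymmDeriv_trans_symm {e : OpenPartialHomeomorph M (Model n)}
    (he : e ∈ IsManifold.maximalAtlas (model n) ∞ M)
    {E : OpenPartialHomeomorph (Model n) (Model n)} (hE : ContDiff ℝ ∞ E) {v : Model n}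
    (hv : E v ∈ e.target) (w : Model n) :
    chartSymmDeriv (e.trans E.symm) v w = chartSymmDeriv e (E v) (fderiv ℝ E v w) := by
  have h := mfderiv_comp v ((mdifferentiable_of_mem_maximalAtlas he).mdifferentiableAt_symm hv)
    (hE.contMDiff.contMDiffAt.mdifferentiableAt (x := v) (n := ∞) (by simp))
  rw [mfderiv_eq_fderiv] at h
  exact congrArg (fun A : Model n →L[ℝ] Model n => A w) h

variable [IsManifold (model n) ∞ M] {θ : ContactForm n M}

/-- Composition of a chart with a diffeomorphism of open sets of the model space. -/
theorem trans_symm_mem_maximalAtlas {e : OpenPartialHomeomorph M (Model n)}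
    (he : e ∈ IsManifold.maximalAtlas (model n) ∞ M)
    {E : OpenPartialHomeomorph (Model n) (Model n)} (hE : ContDiff ℝ ∞ E)
    (hE' : ContDiffOn ℝ ∞ E.symm E.target) :
    e.trans E.symm ∈ IsManifold.maximalAtlas (model n) ∞ M := by
  refine OpenPartialHomeomorph.mem_maximalAtlas_of_contMDiffOn _ ?_ ?_
  · exact hE'.contMDiffOn.comp ((contMDiffOn_of_mem_maximalAtlas he).mono (by simp))
      (fun x hx => by simpa using hx.2)
  · refine (contMDiffOn_symm_of_mem_maximalAtlas he).comp hE.contMDiff.contMDiffOn ?_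
    intro y hy
    simpa using hy.2

/-- A Lagrangian plane that contains the Hamiltonian vector of `f` is the tangent space of a
Lagrangian submanifold on which `f` is constant. -/
theorem exists_lagrangianSubmanifold {f : M → ℝ} (hf : ContMDiff (model n) 𝓘(ℝ, ℝ) ∞ f) {m : M}
    {L : Submodule ℝ (TangentSpace (model n) m)} (hL : IsLagrangianPlane θ m L)
    (hY : θ.hamiltonian f m ∈ L) (hY0 : θ.hamiltonian f m ≠ 0) :
    ∃ S : Set M, IsLagrangianSubmanifold θ S ∧ (∀ q ∈ S, f q = f m) ∧ m ∈ S ∧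
      tangentSpaceOf (n := n) S m = L := by
  let e := chartAt (Model n) m
  have he : e ∈ IsManifold.maximalAtlas (model n) ∞ M := IsManifold.chart_mem_maximalAtlas m
  have hm : m ∈ e.source := mem_chart_source _ m
  let p := e m
  have hp : p ∈ e.target := e.map_source hm
  have hpm : e.symm p = m := e.left_inv hm
  obtain ⟨α, g, h⟩ := exists_isCenteredExpression θ he hf hp
  let D : Model n →ₗ[ℝ] Model n := chartDeriv e m
  have hSD : ∀ u, chartSymmDeriv e p (D u) = u := fun u => chartSymmDeriv_chartDeriv he hm u
  have hDinj : Function.Injective D := fun u v huv => by rw [← hSD u, huv, hSD v]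
  let L₀ : Submodule ℝ (Model n) := L
  have hL₀ : finrank ℝ L₀ = n := hL.finrank_eq
  let W : Submodule ℝ (Model n) := Submodule.map D L₀
  have hW : finrank ℝ W = n := (Submodule.equivMapOfInjective D hDinj L₀).finrank_eq.symm.trans hL₀
  have hWL : ∀ w ∈ W, chartSymmDeriv e p w ∈ L₀ := by
    rintro _ ⟨u, hu, rfl⟩
    rw [hSD]
    exact hu
  have hα0 : ∀ v, α 0 v = covector θ.form m (chartSymmDeriv e p v) := fun v => by
    have := h.form_eq.self_of_nhds v
    rwa [add_zero, hpm] at this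
  let Ω : M → Model n → Model n → ℝ := fun x u v => dForm θ.form x u v
  have hd0 : ∀ u v, extD α 0 u v =
      dForm θ.form m (chartSymmDeriv e p u) (chartSymmDeriv e p v) := fun u v => by
    have : extD α 0 u v = Ω (e.symm (p + 0)) (chartSymmDeriv e (p + 0) u)
      (chartSymmDeriv e (p + 0) v) := h.extD_eq.self_of_nhds u v
    rwa [add_zero, hpm] at this
  have hg0 : ∀ v, fderiv ℝ g 0 v = differential f m (chartSymmDeriv e p v) := fun v => by
    let F : M → Model n →L[ℝ] ℝ := fun x => differential f x
    have : fderiv ℝ g 0 v = F (e.symm (p + 0)) (chartSymmDeriv e (p + 0) v) :=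
      h.fderiv_eq.self_of_nhds v
    rwa [add_zero, hpm] at this
  let w₀ : W := ⟨D (θ.hamiltonian f m), θ.hamiltonian f m, hY, rfl⟩
  have hw₀ : w₀ ≠ 0 := fun h0 => hY0 (hDinj ((congrArg Subtype.val h0).trans (map_zero D).symm))
  -- The nonzero Hamiltonian vector in `L` excludes `n = 0`, so the induction theorem, stated for
  -- dimension `n + 1`, applies with `n - 1`.
  have hn : 0 < n := by
    rw [← hW]
    exact finrank_pos_iff_exists_ne_zero.2 ⟨w₀, hw₀⟩
  obtain ⟨i, hi, hi0, hid, hiα, hig⟩ := exists_isotropicImmersion (n - 1) W (Model n)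
    (by rw [hW]; omega) α g h.contDiff_form h.contDiff_fun (h.isContactAt he) W.subtypeL
    Subtype.val_injective (fun w => (hα0 _).trans (hL.le_plane (hWL _ w.2)))
    (fun w w' => (hd0 _ _).trans (hL.isotropic _ (hWL _ w.2) _ (hWL _ w'.2))) w₀ hw₀
    (differential f m (θ.reeb m)) (fun v => by
      rw [hd0, hg0, hα0]
      exact (congrArg (fun z : Model n => Ω m z (chartSymmDeriv e p v)) (hSD _)).trans
        ((hamiltonian_spec θ f m).2 _))
  let P : Model n →L[ℝ] W := W.orthogonalProjectionOnto
  have hPW : ∀ v : W, P v = v := fun v => W.orthogonalProjectionOnto_mem_subspace_eq_self v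
  -- Extends the immersion `p + i` from `W` to the whole model space by the identity on the
  -- orthogonal complement. Since `i` has the inclusion as derivative at `0`, `G` has identity
  -- derivative there, and its local inverse flattens the image of `i` onto `W`.
  let G : Model n → Model n := fun v => p + (i (P v) + (v - P v))
  have hG : ContDiff ℝ ∞ G := contDiff_const.add ((hi.comp P.contDiff).add
    (contDiff_id.sub (W.subtypeL.comp P).contDiff))
  have hG0 : G 0 = p := by simp [G, hi0]
  have hGd : ∀ v, HasFDerivAt G ((fderiv ℝ i (P v)).comp P +
      (ContinuousLinearMap.id ℝ _ - W.subtypeL.comp P)) v := fun v =>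
    (((hi.differentiable (by simp) _).hasFDerivAt.comp v P.hasFDerivAt).add
      ((hasFDerivAt_id v).sub (W.subtypeL.comp P).hasFDerivAt)).const_add p
  have hGd0 : HasFDerivAt G (ContinuousLinearEquiv.refl ℝ (Model n) : Model n →L[ℝ] Model n) 0 := by
    convert! hGd 0 using 1
    rw [map_zero, hid.fderiv]
    ext1 v
    simp
  have hGW : ∀ v w : W, fderiv ℝ G v w = fderiv ℝ i v w := fun v w => by
    rw [(hGd v).fderiv]
    simp [hPW]
  obtain ⟨E₀, hE₀0, hE₀, hE₀s, -⟩ := exists_smooth_localInverse hG 0 _ hGd0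
  have hPt : Filter.Tendsto P (𝓝 0) (𝓝 0) := by
    have := P.continuous.tendsto 0
    rwa [map_zero] at this
  have hit : Filter.Tendsto (fun v => i (P v)) (𝓝 0) (𝓝 0) := by
    have := (hi.continuous.tendsto 0).comp hPt
    rwa [hi0] at this
  -- Isotropy and constancy of `f` hold only for parameters near `0`. Restricting the chart to `N`
  -- makes them hold at every point of `S`.
  obtain ⟨N, hNev, hN, hN0⟩ := eventually_nhds_iff.1 (((hPt.eventually hiα).and
    (hPt.eventually hig)).and ((hit.eventually h.form_eq).and (hit.eventually h.fun_eq)))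
  let E := E₀.restrOpen N hN
  have hEsrc : E.source = E₀.source ∩ N := E₀.restrOpen_source N hN
  have hE : ⇑E = G := hE₀
  have hE' : ContDiffOn ℝ ∞ E.symm E.target :=
    hE₀s.mono fun y hy => hy.1
  have hE0 : (0 : Model n) ∈ E.source := by
    rw [hEsrc]
    exact ⟨hE₀0, hN0⟩
  let ψ := e.trans E.symm
  have hψ : ψ ∈ IsManifold.maximalAtlas (model n) ∞ M :=
    trans_symm_mem_maximalAtlas he (by rw [hE]; exact hG) hE'
  have hψs : ∀ q, q ∈ ψ.source ↔ q ∈ e.source ∧ e q ∈ E.target := fun q => by simp [ψ]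
  have hψt : ∀ v, v ∈ ψ.target ↔ v ∈ E.source ∧ G v ∈ e.target := fun v => by simp [ψ, hE]
  have hψsymm : ∀ v, ψ.symm v = e.symm (G v) := fun v => by simp [ψ, hE]
  have hψd : ∀ v ∈ ψ.target, ∀ w, chartSymmDeriv ψ v w =
      chartSymmDeriv e (G v) (fderiv ℝ G v w) := fun v hv w => by
    have := chartSymmDeriv_trans_symm (E := E) he (by rw [hE]; exact hG) (v := v)
      (by rw [hE]; exact ((hψt v).1 hv).2) w
    rwa [hE] at this
  have hpE : p ∈ E.target := by
    have := E.map_source hE0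
    rwa [hE, hG0] at this
  have hmψ : m ∈ ψ.source := (hψs m).2 ⟨hm, hpE⟩
  have hψm : ψ m = 0 := by
    change E.symm p = 0
    rw [← hG0, ← hE]
    exact E.left_inv hE0
  let S : Set M := {q | q ∈ ψ.source ∧ ψ q ∈ W}
  have hSW : ψ '' (S ∩ ψ.source) = ψ.target ∩ (W : Set (Model n)) := by
    ext v
    constructor
    · rintro ⟨q, ⟨hq, hq'⟩, rfl⟩
      exact ⟨ψ.map_source hq', hq.2⟩
    · rintro ⟨hv, hvW⟩
      refine ⟨ψ.symm v, ⟨⟨ψ.map_target hv, ?_⟩, ψ.map_target hv⟩, ψ.right_inv hv⟩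
      rw [ψ.right_inv hv]
      exact hvW
  have hmS : m ∈ S := ⟨hmψ, by rw [hψm]; exact W.zero_mem⟩
  have hpoint : ∀ q (hq : q ∈ S), q = e.symm (p + i ⟨ψ q, hq.2⟩) ∧
      pullForm i α ⟨ψ q, hq.2⟩ = 0 ∧ g (i ⟨ψ q, hq.2⟩) = g 0 ∧
      (∀ v, α (i ⟨ψ q, hq.2⟩) v = covector θ.form (e.symm (p + i ⟨ψ q, hq.2⟩))
        (chartSymmDeriv e (p + i ⟨ψ q, hq.2⟩) v)) ∧
      g (i ⟨ψ q, hq.2⟩) = f (e.symm (p + i ⟨ψ q, hq.2⟩)) ∧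
      G (ψ q) = p + i ⟨ψ q, hq.2⟩ := by
    intro q hq
    have hPq : P (ψ q) = ⟨ψ q, hq.2⟩ := hPW ⟨ψ q, hq.2⟩
    have hqN : ψ q ∈ N := by
      have := ((hψt _).1 (ψ.map_source hq.1)).1
      rw [hEsrc] at this
      exact this.2
    have hGq : G (ψ q) = p + i ⟨ψ q, hq.2⟩ := by
      simp only [G, hPq, sub_self, add_zero]
    obtain ⟨⟨h1, h2⟩, h3, h4⟩ := hNev _ hqN
    rw [hPq] at h1 h2 h3 h4
    refine ⟨?_, h1, h2, h3, h4, hGq⟩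
    rw [← hGq, ← hψsymm, ψ.left_inv hq.1]
  refine ⟨S, ⟨fun q hq => ⟨ψ, hψ, hq.1, W, hW, hSW⟩, fun q hq u hu => ?_⟩, fun q hq => ?_, hmS, ?_⟩
  · have hw := chartDeriv_mem_of_mem_tangentSpaceOf hψ hq.1 hSW hu
    obtain ⟨h1, h2, -, h3, -, h4⟩ := hpoint q hq
    have hu' : chartSymmDeriv ψ (ψ q) (chartDeriv ψ q u) = u :=
      chartSymmDeriv_chartDeriv hψ hq.1 u
    change covector θ.form q u = 0
    rw [← hu', hψd _ (ψ.map_source hq.1), h4,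
      hGW ⟨ψ q, hq.2⟩ ⟨chartDeriv ψ q u, hw⟩]
    have h5 := h3 (fderiv ℝ i ⟨ψ q, hq.2⟩ ⟨chartDeriv ψ q u, hw⟩)
    rw [← h1] at h5
    rw [← h5]
    exact congrArg (fun A : W →L[ℝ] ℝ => A ⟨chartDeriv ψ q u, hw⟩) h2
  · obtain ⟨h1, -, h2, -, h3, -⟩ := hpoint q hq
    have h4 := h.fun_eq.self_of_nhds
    rw [add_zero, hpm] at h4
    rw [h1, ← h3, h2, h4]
  · have h0 : ∀ w, chartSymmDeriv ψ (ψ m) w = chartSymmDeriv e p w := fun w => by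
      rw [hψd _ (ψ.map_source hmψ), hψm, hG0, hGd0.fderiv]
      rfl
    refine le_antisymm (fun u hu => ?_) (fun u hu => ?_)
    · have hw := chartDeriv_mem_of_mem_tangentSpaceOf hψ hmψ hSW hu
      have hu' : chartSymmDeriv ψ (ψ m) (chartDeriv ψ m u) = u :=
        chartSymmDeriv_chartDeriv hψ hmψ u
      rw [h0] at hu'
      have := hWL _ hw
      rwa [hu'] at this
    · have := chartSymmDeriv_mem_tangentSpaceOf hψ hmψ hmS hSW
        (⟨u, hu, rfl⟩ : D u ∈ W)
      exact (congrArg (fun z : Model n => z ∈ (tangentSpaceOf (n := n) S m : Submodule ℝ (Model n)))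
        ((h0 _).trans (hSD u))).mp this

end Existence

/-! ### Strongly characteristic lines of the Hamiltonian field -/

section Characteristics

variable {n : ℕ} {M : Type*} [TopologicalSpace M] [ChartedSpace (Model n) M]
  [IsManifold (model n) ∞ M] {θ : ContactForm n M}

/-- All integral curves of the Hamiltonian field are strongly characteristic if and only if the
lines spanned by the field are. -/
theorem forall_integralCurve_isStronglyCharacteristic_iff (E : Set (Prolongation θ)) {f : M → ℝ}
    (hf : ContMDiff (model n) 𝓘(ℝ, ℝ) ∞ f) :
    (∀ (γ : ℝ → M) (a b : ℝ), IsMIntegralCurveOn γ (θ.hamiltonian f) (Set.Ioo a b) →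
        IsStronglyCharacteristicCurve θ E γ (Set.Ioo a b)) ↔
      ∀ m, IsStronglyCharacteristic θ E m (Submodule.span ℝ {θ.hamiltonian f m}) := by
  have hvel : ∀ (γ : ℝ → M) (a b : ℝ), IsMIntegralCurveOn γ (θ.hamiltonian f) (Set.Ioo a b) →
      ∀ t ∈ Ioo a b, mfderiv 𝓘(ℝ, ℝ) (model n) γ t (1 : ℝ) = θ.hamiltonian f (γ t) := by
    intro γ a b hγ t ht
    have h1 := ((hγ t ht).hasMFDerivAt (Ioo_mem_nhds ht.1 ht.2)).mfderiv
    have h2 := congrArg (fun A : ℝ →L[ℝ] Model n => A 1) h1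
    exact h2.trans (one_smul ℝ (θ.hamiltonian f (γ t) : Model n))
  constructor
  · intro h m
    obtain ⟨γ, ε, hε, rfl, hγ⟩ := exists_integralCurve_hamiltonian (θ := θ) hf m
    have h0 : (0 : ℝ) ∈ Ioo (-ε) ε := ⟨by linarith, hε⟩
    have := h γ _ _ hγ 0 h0
    rwa [hvel γ _ _ hγ 0 h0] at this
  · intro h γ a b hγ t ht
    rw [hvel γ a b hγ t ht]
    exact h (γ t)

/-- A nonzero vector in the `2n`-dimensional contact plane forces `n ≥ 1`, so the condition `L ⊇ U ∩
𝒞_m` always applies to the line `U`. The reverse inclusion is required only for `n = 1`, where it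
follows by equality of dimensions. -/
theorem prolongSubspace_span_hamiltonian {f : M → ℝ} {m : M} (hY : θ.hamiltonian f m ≠ 0)
    {L : Submodule ℝ (TangentSpace (model n) m)} (hL : IsLagrangianPlane θ m L) :
    (⟨m, L, hL⟩ : Prolongation θ) ∈
        prolongSubspace θ m (Submodule.span ℝ {θ.hamiltonian f m}) ↔ θ.hamiltonian f m ∈ L := by
  have hplane : Submodule.span ℝ {θ.hamiltonian f m} ≤ θ.plane m := by
    rw [Submodule.span_singleton_le_iff_mem]
    exact (hamiltonian_spec θ f m).1
  have h1 : finrank ℝ (Submodule.span ℝ {θ.hamiltonian f m}) = 1 := finrank_span_singleton hY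
  have hn : 1 ≤ n := by
    have h2 := Submodule.finrank_mono hplane
    have h3 := finrank_contactPlane (θ := θ) m
    omega
  constructor
  · rintro ⟨L', hL', heq, hle, -⟩
    obtain rfl : L = L' := by injection heq
    exact hle (by omega) ⟨Submodule.mem_span_singleton_self _, (hamiltonian_spec θ f m).1⟩
  · intro hmem
    have hspan : Submodule.span ℝ {θ.hamiltonian f m} ≤ L := by
      rwa [Submodule.span_singleton_le_iff_mem]
    refine ⟨L, hL, rfl, fun _ => inf_le_left.trans hspan, fun hle => ?_⟩
    rw [inf_eq_left.2 hplane, Submodule.eq_of_le_of_finrank_le hspan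
      (hL.finrank_eq.trans_le hle)]

end Characteristics

end ContactGeometry

end

/-! ### The equivalence -/

theorem mainTheorem8 {n : ℕ} {M : Type*} [TopologicalSpace M] [T2Space M]
    [SecondCountableTopology M] [ChartedSpace (Model n) M] [IsManifold (model n) ∞ M]
    (θ : ContactForm n M) (E : Set (Prolongation θ)) (f : M → ℝ)
    (hf : ContMDiff (model n) 𝓘(ℝ, ℝ) ∞ f) (hreg : ∀ m, θ.hamiltonian f m ≠ 0) :
    IsIntermediateIntegral θ E f ↔
      ∀ (γ : ℝ → M) (a b : ℝ), IsMIntegralCurveOn γ (θ.hamiltonian f) (Set.Ioo a b) →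
        IsStronglyCharacteristicCurve θ E γ (Set.Ioo a b) := by
  rw [forall_integralCurve_isStronglyCharacteristic_iff E hf]
  constructor
  · rintro h m q hq
    obtain ⟨L, hL, rfl, -⟩ := id hq
    have hY := (prolongSubspace_span_hamiltonian (hreg m) hL).1 hq
    obtain ⟨S, hS, hfS, hmS, hT⟩ := exists_lagrangianSubmanifold hf hL hY (hreg m)
    -- It remains to see `(m, L) ∈ S^(1)`, which holds because `T_m S = L` lies in the prolongation
    -- of itself.
    refine (h (f m) S ⟨hS, fun q hq => sub_eq_zero.2 (hfS q hq)⟩).2 ?_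
    refine mem_iUnion₂.2 ⟨m, hmS, ?_⟩
    rw [hT]
    exact ⟨L, hL, rfl, fun _ => inf_le_left, fun _ => le_inf le_rfl hL.le_plane⟩
  · intro h c S hS
    refine ⟨hS.1, fun q hq => ?_⟩
    obtain ⟨m, hmS, L, hL, rfl, -, hle⟩ := mem_iUnion₂.1 hq
    have hLT := (hle (le_finrank_tangentSpaceOf hS.1.isSubmanifold hmS)).trans inf_le_left
    refine h m ((prolongSubspace_span_hamiltonian (hreg m) hL).2 ?_)
    -- By maximality of `L` it suffices that `dθ(Y_f, v) = df(v) - df(Z) θ(v)` vanishes on `L`. Here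
    -- `θ(v) = 0` as `L ⊆ 𝒞_m`, and `df(v) = 0` as `v` is tangent to `S`, on which `f - c` vanishes.
    refine hL.mem_of_forall (hamiltonian_spec θ f m).1 fun v hv => ?_
    have hdf : differential f m v = 0 := by
      have h1 := hLT hv (fun x => f x - c) (hf.sub contMDiff_const).contMDiffAt (by
        filter_upwards [self_mem_nhdsWithin] with x hx using hS.2 hx)
      have h2 := (hf.contMDiffAt.mdifferentiableAt (x := m) (by simp)).hasMFDerivAt.sub
        (hasMFDerivAt_const c m)
      have h3 := h2.mfderiv
      have h4 := congrArg (fun A : Model n →L[ℝ] ℝ => A v) h3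
      exact (sub_zero (differential f m v)).symm.trans (h4.symm.trans h1)
    have hθ : θ.form m v = 0 := hL.le_plane hv
    rw [(hamiltonian_spec θ f m).2, hdf, hθ, mul_zero, sub_zero]
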